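/- Let $K\ge 3$. A $K$-user discrete memoryless interference channel (DMIC) has finite input alphabets $\mathcal X_1,\dots,\mathcal X_K$, finite output alphabets $\mathcal Y_1,\dots,\mathcal Y_K$ and a transition probability $p(y_1,\dots,y_K\mid x_1,\dots,x_K)$; it is used without memory. User $i$ encodes its own message $W_i$ into a codeword $X_i^n$; the messages are independent, and $W_i$ is uniform on a set of $\lceil 2^{nR_i}\rceil$ elements. Receiver $i$ estimates $W_i$ from $Y_i^n$ alone. A tuple $(R_1,\dots,R_K)$ of nonnegative reals is achievable if there is a sequence of such codes, one for each block length $n$, for which the probability that at least one receiver errs tends to $0$ as $n\to\infty$; the capacity region is the closure of the set of achievable tuples. Write $\overline{X_m}=\{X_i : i\neq m\}$. Suppose that for each receiver $j\in\{1,\dots,K\}$ there is a user $l_j\neq j$ (the strong interferer at $j$) such that $$I[X_{l_j};Y_{l_j}\mid \overline{X_{l_j}}]\le I[X_{l_j};Y_j\mid \overline{X_{l_j}}]$$ for all product input distributions $p_{X_1}(x_1)\cdots p_{X_K}(x_K)$, and that each of the $K-2$ remaining users $m\in\overline{l_j}:=\{1,\dots,K\}\setminus\{j,l_j\}$ is a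 very strong interferer at $j$, that is, $$I[X_m;Y_j]\ge I[X_m;Y_m\mid \overline{X_m}]$$ for all product input distributions. Write $X_{\overline{l_j}}=\{X_i : i\in\overline{l_j}\}$. Then the capacity region of the channel is exactly the set of all tuples $(R_1,\dots,R_K)$ of nonnegative reals for which there is a joint distribution $p_Q(q)\,p_{X_1|Q}(x_1|q)\cdots p_{X_K|Q}(x_K|q)$, with $Q$ taking at most $2K+1$ values, such that $$R_i\le I[X_i;Y_i\mid \overline{X_i},Q]\quad\text{for all } i\in\{1,\dots,K\},$$ $$R_j+R_{l_j}\le I[X_j,X_{l_j};Y_j\mid X_{\overline{l_j}},Q]\quad\text{for all } j\in\{1,\dots,K\}.$$ All mutual informations are in bits, and given the inputs the outputs are distributed according to $p(y_1,\dots,y_K\mid x_1,\dots,x_K)$. -/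

import Mathlib

open Filter Topology

/-! ### Entropy and mutual information of finitely valued random variables

A probability space is a finite type `Ω` with a mass function `P : Ω → ℝ`; a random variable is a
function on `Ω`. All information quantities are in bits. -/

namespace InfoTheory

variable {Ω α β γ : Type*} [Fintype Ω] [Fintype α] [Fintype β] [Fintype γ]

open Classical in
/-- The mass function of the random variable `f`. -/
noncomputable def law (P : Ω → ℝ) (f : Ω → α) (a : α) : ℝ :=
  ∑ ω, if f ω = a then P ω else 0

/-- Shannon entropy `H(A) = -∑ p(a) log₂ p(a)`. -/
noncomputable def entropy (P : Ω → ℝ) (A : Ω → α) : ℝ :=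
  (∑ a, Real.negMulLog (law P A a)) / Real.log 2

/-- Conditional entropy `H(A | C) = H(A, C) - H(C)`. -/
noncomputable def condEntropy (P : Ω → ℝ) (A : Ω → α) (C : Ω → γ) : ℝ :=
  entropy P (fun ω => (A ω, C ω)) - entropy P C

/-- Mutual information `I[A; B] = H(A) - H(A | B)`. -/
noncomputable def mutualInfo (P : Ω → ℝ) (A : Ω → α) (B : Ω → β) : ℝ :=
  entropy P A - condEntropy P A B

/-- Conditional mutual information `I[A; B | C] = H(A | C) - H(A | B, C)`. -/
noncomputable def condMutualInfo (P : Ω → ℝ) (A : Ω → α) (B : Ω → β) (C : Ω → γ) : ℝ :=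
  condEntropy P A C - condEntropy P A (fun ω => (B ω, C ω))

end InfoTheory

/-! ### The `K`-user discrete memoryless interference channel -/

namespace DMIC

open InfoTheory

/-- A `K`-user interference channel with input alphabets `X i` and output alphabets `Y i`: a
transition probability `p(y_1, …, y_K | x_1, …, x_K)`. -/
abbrev Channel (K : ℕ) (X Y : Fin K → Type*) [∀ i, Fintype (Y i)] :=
  (∀ i, X i) → stdSimplex ℝ (∀ i, Y i)

/-- A code of block length `n` with `M i` messages for user `i`: user `i` encodes its own message
alone, and receiver `i` estimates the message of user `i` from its own output sequence alone. -/
structure Code {K : ℕ} (X Y : Fin K → Type*) (M : Fin K → ℕ) (n : ℕ) where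
  enc : ∀ i, Fin (M i) → Fin n → X i
  dec : ∀ i, (Fin n → Y i) → Fin (M i)

variable {K : ℕ} {X Y : Fin K → Type*} [∀ i, Fintype (X i)] [∀ i, Fintype (Y i)]

/-- The average probability that some receiver errs, for independent uniformly distributed
messages and `n` memoryless uses of the channel. -/
noncomputable def errorProb (W : Channel K X Y) {M : Fin K → ℕ} {n : ℕ} (c : Code X Y M n) : ℝ :=
  (∑ w : ∀ i, Fin (M i), ∑ y : Fin n → ∀ i, Y i,
    if (fun i => c.dec i (fun k => y k i)) ≠ w then
      ∏ k, (W (fun i => c.enc i (w i) k)).1 (y k)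
    else 0) / ∏ i, (M i : ℝ)

/-- The rate tuple `R` is achievable: some sequence of codes with `2 ^ (n R_i)` messages (rounded
up to an integer) for user `i` has average error probability tending to `0`. -/
def Achievable (W : Channel K X Y) (R : Fin K → ℝ) : Prop :=
  (∀ i, 0 ≤ R i) ∧
    ∃ c : ∀ n : ℕ, Code X Y (fun i => ⌈(2 : ℝ) ^ ((n : ℝ) * R i)⌉₊) n,
      Tendsto (fun n => errorProb W (c n)) atTop (𝓝 0)

/-- The capacity region: the closure of the set of achievable rate tuples. -/
def capacityRegion (W : Channel K X Y) : Set (Fin K → ℝ) :=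
  closure {R | Achievable W R}

/-- The joint mass function `p(x_1) ⋯ p(x_K) p(y | x)` of inputs and outputs. -/
noncomputable def joint (W : Channel K X Y) (p : ∀ i, stdSimplex ℝ (X i))
    (ω : (∀ i, X i) × (∀ i, Y i)) : ℝ :=
  (∏ i, (p i).1 (ω.1 i)) * (W ω.1).1 ω.2

/-- User `m` is a strong interferer at receiver `j`: `I[X_m; Y_m | X_{≠ m}] ≤ I[X_m; Y_j | X_{≠ m}]`
for all product input distributions. -/
def IsStrong (W : Channel K X Y) (m j : Fin K) : Prop :=
  ∀ p : ∀ i, stdSimplex ℝ (X i),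
    condMutualInfo (joint W p) (fun ω => ω.1 m) (fun ω => ω.2 m)
        (fun ω => Finset.restrict {m}ᶜ ω.1) ≤
      condMutualInfo (joint W p) (fun ω => ω.1 m) (fun ω => ω.2 j)
        (fun ω => Finset.restrict {m}ᶜ ω.1)

/-- User `m` is a very strong interferer at receiver `j`: `I[X_m; Y_j] ≥ I[X_m; Y_m | X_{≠ m}]`
for all product input distributions. -/
def IsVeryStrong (W : Channel K X Y) (m j : Fin K) : Prop :=
  ∀ p : ∀ i, stdSimplex ℝ (X i),
    mutualInfo (joint W p) (fun ω => ω.1 m) (fun ω => ω.2 j) ≥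
      condMutualInfo (joint W p) (fun ω => ω.1 m) (fun ω => ω.2 m)
        (fun ω => Finset.restrict {m}ᶜ ω.1)

/-- The joint mass function `p(q) p(x_1 | q) ⋯ p(x_K | q) p(y | x)` of the time-sharing variable
(with values in `Fin s`), the inputs and the outputs. -/
noncomputable def jointTS (W : Channel K X Y) {s : ℕ} (pQ : stdSimplex ℝ (Fin s))
    (p : ∀ i, Fin s → stdSimplex ℝ (X i)) (ω : Fin s × (∀ i, X i) × (∀ i, Y i)) : ℝ :=
  pQ.1 ω.1 * (∏ i, (p i ω.1).1 (ω.2.1 i)) * (W ω.2.1).1 ω.2.2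

/-- The region of nonnegative rate tuples such that, for some time-sharing variable `Q` with at
most `N` values and inputs that are conditionally independent given `Q`,
`R_i ≤ I[X_i; Y_i | X_{≠ i}, Q]` for all `i` and
`R_j + R_{l j} ≤ I[X_j, X_{l j}; Y_j | X_{∉ {j, l j}}, Q]` for all `j`. -/
def rateRegion (W : Channel K X Y) (l : Fin K → Fin K) (N : ℕ) : Set (Fin K → ℝ) :=
  {R | (∀ i, 0 ≤ R i) ∧
    ∃ s ≤ N, ∃ (pQ : stdSimplex ℝ (Fin s)) (p : ∀ i, Fin s → stdSimplex ℝ (X i)),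
      (∀ i, R i ≤ condMutualInfo (jointTS W pQ p) (fun ω => ω.2.1 i) (fun ω => ω.2.2 i)
        (fun ω => (Finset.restrict {i}ᶜ ω.2.1, ω.1))) ∧
      (∀ j, R j + R (l j) ≤ condMutualInfo (jointTS W pQ p)
        (fun ω => (ω.2.1 j, ω.2.1 (l j))) (fun ω => ω.2.2 j)
        (fun ω => (Finset.restrict {j, l j}ᶜ ω.2.1, ω.1)))}

end DMIC

/-! For independent inputs every information quantity here is a difference of output entropies: with
`H_j(S)` the entropy of the output at `j` given the inputs outside `S` (`rcvEntropy`), `I[X_S; Y_j |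
X_{Sᶜ}]` is `H_j(S) - H_j(∅)` (`rcvInfo`). The input entropies and the entropy of `Q` cancel. Both
directions are comparisons between such differences.

Converse. Fano's inequality at receiver `i`, with the messages outside a set given as side
information, bounds `log M_i` by a difference of block output entropies (`log_le_of_errorProb`). For
the sum bound at `j`, the rate of `l j` is first bounded at its own receiver. Strong interference
then moves that information to receiver `j`, and the two bounds telescope. The move needs the
hypothesis for blocks, where the letters of a codeword are dependent. With the other messages fixed,
strong interference says that one channel is more capable than another, and this order is preserved
by memoryless products (`MoreCapable.pi`, `IsStrong.outEntropy_block_le`). Subadditivity reduces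
blocks to letters, averaging over time gives a convex combination, Carathéodory's theorem bounds the
number of values of `Q`, and closedness of the region allows the limit in the block length.

Achievability. Every receiver decodes all messages, using random codebooks and one
information-density threshold test for each set `S` of users that could be wrong. This works if the
rates in `S` sum to less than `I[X_S; Y_j | X_{Sᶜ}, Q]` for all `j` and all relevant `S`
(`achievable_of_lt_tsInfo`). The rate region gives the weak form of these inequalities
(`sum_rate_le_tsInfo`): for subsets of `{j, l j}` they are the given bounds combined with strong
interference, and each further user `m` adds `I[X_m; Y_j | X_T]` for some set `T` of the other
users. By independence this is at least `I[X_m; Y_j]`, hence at least `R_m` by very strong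
interference. Shrinking the rates slightly makes the inequalities strict. -/

set_option linter.unusedSectionVars false

/-! ### Entropy as an expectation; the inequalities of Gibbs and Fano, and submodularity. -/

namespace InfoTheory

section Law

variable {Ω α β γ : Type*} [Fintype Ω]

lemma law_nonneg {P : Ω → ℝ} (hP : ∀ ω, 0 ≤ P ω) (f : Ω → α) (a : α) : 0 ≤ law P f a := by
  unfold law
  exact Finset.sum_nonneg fun ω _ => by split_ifs <;> simp [hP]

lemma le_law_self {P : Ω → ℝ} (hP : ∀ ω, 0 ≤ P ω) (f : Ω → α) (ω : Ω) : P ω ≤ law P f (f ω) := by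
  classical
  unfold law
  refine le_trans ?_ (Finset.single_le_sum (f := fun ω' => if f ω' = f ω then P ω' else 0)
    (fun ω' _ => by split_ifs <;> simp [hP]) (Finset.mem_univ ω))
  simp

lemma law_self_pos {P : Ω → ℝ} (hP : ∀ ω, 0 ≤ P ω) (f : Ω → α) {ω : Ω} (h : P ω ≠ 0) :
    0 < law P f (f ω) :=
  lt_of_lt_of_le (lt_of_le_of_ne (hP ω) h.symm) (le_law_self hP f ω)

lemma sum_law_mul [Fintype α] (P : Ω → ℝ) (f : Ω → α) (F : α → ℝ) :
    ∑ a, law P f a * F a = ∑ ω, P ω * F (f ω) := by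
  classical
  simp only [law, Finset.sum_mul]
  rw [Finset.sum_comm]
  refine Finset.sum_congr rfl fun ω _ => ?_
  rw [Finset.sum_eq_single (f ω)]
  · simp
  · intro a _ h; simp [h.symm]
  · simp

lemma sum_law [Fintype α] (P : Ω → ℝ) (f : Ω → α) : ∑ a, law P f a = ∑ ω, P ω := by
  simpa using sum_law_mul P f (fun _ => 1)

lemma law_comp_congr {P : Ω → ℝ} {f : Ω → α} {g : Ω → β}
    (h : ∀ ω ω', f ω = f ω' ↔ g ω = g ω') (ω : Ω) : law P f (f ω) = law P g (g ω) := by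
  unfold law
  refine Finset.sum_congr rfl fun ω' _ => ?_
  by_cases e : f ω' = f ω
  · rw [if_pos e, if_pos ((h ω' ω).1 e)]
  · rw [if_neg e, if_neg fun e' => e ((h ω' ω).2 e')]

/-- Shannon entropy in nats, as the expectation of the information content. -/
noncomputable def natEntropy (P : Ω → ℝ) (f : Ω → α) : ℝ :=
  -∑ ω, P ω * Real.log (law P f (f ω))

lemma entropy_eq [Fintype α] (P : Ω → ℝ) (f : Ω → α) : entropy P f = natEntropy P f / Real.log 2 := by
  unfold entropy natEntropy
  rw [← sum_law_mul P f (fun a => Real.log (law P f a)), ← Finset.sum_neg_distrib]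
  simp [Real.negMulLog]

/-- Entropy sees only the partition of `Ω` into fibres. This is the tool for reordering tuples and
for trading a single coordinate for a restriction to a set of coordinates. -/
lemma natEntropy_congr {P : Ω → ℝ} {f : Ω → α} {g : Ω → β}
    (h : ∀ ω ω', f ω = f ω' ↔ g ω = g ω') : natEntropy P f = natEntropy P g := by
  unfold natEntropy
  simp only [law_comp_congr h]

/-- Gibbs' inequality. -/
lemma natEntropy_le_crossEntropy [Fintype α] {P : Ω → ℝ} (hP : ∀ ω, 0 ≤ P ω) (f : Ω → α) (r : α → ℝ)
    (hr : ∀ a, 0 ≤ r a) (hr1 : ∑ a, r a ≤ ∑ ω, P ω) (hpos : ∀ ω, P ω ≠ 0 → r (f ω) ≠ 0) :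
    natEntropy P f ≤ -∑ ω, P ω * Real.log (r (f ω)) := by
  classical
  -- This is `log x ≤ x - 1` at the ratio of `r` to the law, weighted by `P`. Points of zero mass
  -- are separated because there the ratio may have a zero argument in the logarithm.
  have key : ∀ ω, P ω * Real.log (r (f ω)) - P ω * Real.log (law P f (f ω)) ≤
      P ω * (r (f ω) / law P f (f ω)) - P ω := by
    intro ω
    by_cases h : P ω = 0
    · simp [h]
    have h1 := law_self_pos hP f h
    have h2 : 0 < r (f ω) := lt_of_le_of_ne (hr _) (hpos ω h).symm
    rw [← mul_sub, ← Real.log_div h2.ne' h1.ne']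
    have := Real.log_le_sub_one_of_pos (div_pos h2 h1)
    nlinarith [hP ω]
  have hsum := Finset.sum_le_sum fun ω (_ : ω ∈ Finset.univ) => key ω
  rw [Finset.sum_sub_distrib, Finset.sum_sub_distrib,
    ← sum_law_mul P f (fun a => r a / law P f a)] at hsum
  have : ∑ a, law P f a * (r a / law P f a) ≤ ∑ a, r a :=
    Finset.sum_le_sum fun a _ => by
      by_cases h : law P f a = 0
      · simp [h, hr]
      · rw [mul_div_cancel₀ _ h]
  unfold natEntropy
  linarith

lemma sum_law_prod [Fintype α] (P : Ω → ℝ) (D : Ω → α) (C : Ω → γ) (c : γ) :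
    ∑ d, law P (fun ω => (D ω, C ω)) (d, c) = law P C c := by
  classical
  unfold law
  rw [Finset.sum_comm]
  refine Finset.sum_congr rfl fun ω _ => ?_
  rw [Finset.sum_eq_single (D ω)]
  · simp
  · intro d _ h; simp [h.symm]
  · simp

/-- Submodularity of the entropy. -/
lemma natEntropy_submodular [Fintype α] [Fintype β] [Fintype γ] {P : Ω → ℝ} (hP : ∀ ω, 0 ≤ P ω) (A : Ω → α) (B : Ω → β) (C : Ω → γ) :
    natEntropy P (fun ω => (A ω, B ω, C ω)) + natEntropy P C ≤
      natEntropy P (fun ω => (A ω, C ω)) + natEntropy P (fun ω => (B ω, C ω)) := by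
  classical
  -- The comparison law for Gibbs makes `A` and `B` conditionally independent given `C`, with the
  -- correct pair marginals.
  set r : α × β × γ → ℝ := fun x => law P (fun ω => (A ω, C ω)) (x.1, x.2.2) *
    law P (fun ω => (B ω, C ω)) x.2 / law P C x.2.2 with hr
  have h := natEntropy_le_crossEntropy hP (fun ω => (A ω, B ω, C ω)) r
    (fun x => div_nonneg (mul_nonneg (law_nonneg hP _ _) (law_nonneg hP _ _)) (law_nonneg hP _ _))
    (by
      rw [Fintype.sum_prod_type]
      simp only [Fintype.sum_prod_type, hr]
      rw [Finset.sum_comm' (t' := Finset.univ) (s' := fun _ => Finset.univ) (by simp)]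
      calc ∑ b : β, ∑ a : α, ∑ c : γ, law P (fun ω => (A ω, C ω)) (a, c) *
            law P (fun ω => (B ω, C ω)) (b, c) / law P C c
          = ∑ c : γ, (∑ a, law P (fun ω => (A ω, C ω)) (a, c)) *
            (∑ b, law P (fun ω => (B ω, C ω)) (b, c)) / law P C c := by
            simp only [Finset.sum_mul_sum, Finset.sum_div]
            rw [Finset.sum_comm]
            conv_rhs => rw [Finset.sum_comm]
            refine Finset.sum_congr rfl fun a _ => ?_
            rw [Finset.sum_comm]
        _ = ∑ c, law P C c := by
            refine Finset.sum_congr rfl fun c _ => ?_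
            rw [sum_law_prod, sum_law_prod]
            by_cases h : law P C c = 0
            · simp [h]
            · field_simp
        _ ≤ ∑ ω, P ω := (sum_law P C).le)
    (fun ω hω => by
      have h1 := law_self_pos hP (fun ω => (A ω, C ω)) hω
      have h2 := law_self_pos hP (fun ω => (B ω, C ω)) hω
      have h3 := law_self_pos hP C hω
      exact (div_pos (mul_pos h1 h2) h3).ne')
  have e : ∑ ω, P ω * Real.log (r (A ω, B ω, C ω)) =
      ∑ ω, P ω * Real.log (law P (fun ω => (A ω, C ω)) (A ω, C ω)) +
      ∑ ω, P ω * Real.log (law P (fun ω => (B ω, C ω)) (B ω, C ω)) -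
      ∑ ω, P ω * Real.log (law P C (C ω)) := by
    rw [← Finset.sum_add_distrib, ← Finset.sum_sub_distrib]
    refine Finset.sum_congr rfl fun ω _ => ?_
    by_cases h : P ω = 0
    · simp [h]
    have h1 := law_self_pos hP (fun ω => (A ω, C ω)) h
    have h2 := law_self_pos hP (fun ω => (B ω, C ω)) h
    have h3 := law_self_pos hP C h
    simp only [hr]
    rw [Real.log_div (mul_pos h1 h2).ne' h3.ne', Real.log_mul h1.ne' h2.ne']
    ring
  rw [e] at h
  unfold natEntropy at h ⊢
  linarith

/-- Fano's inequality: if `A` is estimated from `B` with error probability `ε`, then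
`H(A | B) ≤ log 2 + ε log |α|`. -/
lemma fano [Fintype α] [Fintype β] {P : Ω → ℝ} (hP : ∀ ω, 0 ≤ P ω) (hP1 : ∑ ω, P ω = 1) (A : Ω → α) (B : Ω → β)
    (g : β → α) :
    natEntropy P (fun ω => (A ω, B ω)) - natEntropy P B ≤
      Real.log 2 + (law P (fun ω => g (B ω) ≠ A ω) True) * Real.log (Fintype.card α) := by
  classical
  rcases isEmpty_or_nonempty α with hα | hα
  · have : IsEmpty Ω := ⟨fun ω => hα.elim (A ω)⟩
    simp at hP1
  have hc : (0 : ℝ) < Fintype.card α := by exact_mod_cast Fintype.card_pos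
  -- `q` puts half of the mass on the guess and spreads the other half uniformly. `q'` omits the
  -- uniform share at the guess. It has total mass at most one, which suffices for Gibbs, and `-log
  -- q'` is exactly `log 2`, plus `log |α|` when the guess is wrong.
  set q : α → β → ℝ := fun a b => (if g b = a then 1 / 2 else 0) + 1 / (2 * Fintype.card α) with hq
  set q' : α → β → ℝ := fun a b => if g b = a then 1 / 2 else 1 / (2 * Fintype.card α) with hq'
  have q'pos : ∀ a b, 0 < q' a b := by
    intro a b; simp only [hq']; split_ifs <;> positivity
  have q'sum : ∀ b, ∑ a, q' a b ≤ 1 := by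
    intro b
    calc ∑ a, q' a b ≤ ∑ a, q a b := Finset.sum_le_sum fun a _ => by
          simp only [hq, hq']; split_ifs
          · simp
          · simp
      _ = 1 := by
          simp only [hq, Finset.sum_add_distrib, Finset.sum_ite_eq, Finset.mem_univ, if_true,
            Finset.sum_const, Finset.card_univ, nsmul_eq_mul]
          field_simp; norm_num
  have h := natEntropy_le_crossEntropy hP (fun ω => (A ω, B ω)) (fun x => q' x.1 x.2 * law P B x.2)
    (fun x => mul_nonneg (q'pos _ _).le (law_nonneg hP _ _))
    (by
      rw [Fintype.sum_prod_type, Finset.sum_comm, ← sum_law P B]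
      refine Finset.sum_le_sum fun b _ => ?_
      simp only [← Finset.sum_mul]
      exact mul_le_of_le_one_left (law_nonneg hP _ _) (q'sum b))
    (fun ω hω => (mul_pos (q'pos _ _) (law_self_pos hP B hω)).ne')
  have e : -∑ ω, P ω * Real.log (q' (A ω) (B ω) * law P B (B ω)) ≤
      natEntropy P B + ∑ ω, P ω * (Real.log 2 +
        (if g (B ω) ≠ A ω then 1 else 0) * Real.log (Fintype.card α)) := by
    unfold natEntropy
    rw [← Finset.sum_neg_distrib, ← Finset.sum_neg_distrib, ← Finset.sum_add_distrib]
    refine Finset.sum_le_sum fun ω _ => ?_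
    by_cases h : P ω = 0
    · simp [h]
    rw [Real.log_mul (q'pos _ _).ne' (law_self_pos hP B h).ne']
    have : -Real.log (q' (A ω) (B ω)) = Real.log 2 +
        (if g (B ω) ≠ A ω then 1 else 0) * Real.log (Fintype.card α) := by
      simp only [hq']
      by_cases h' : g (B ω) = A ω
      · simp [h', ← Real.log_inv]
      · simp only [h', if_false, ne_eq, not_false_eq_true, if_true, one_mul, one_div, Real.log_inv,
          neg_neg]
        rw [Real.log_mul (by norm_num) hc.ne']
    rw [← this]
    apply le_of_eq; ring
  have e2 : ∑ ω, P ω * (Real.log 2 +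
        (if g (B ω) ≠ A ω then 1 else 0) * Real.log (Fintype.card α)) =
      Real.log 2 + (law P (fun ω => g (B ω) ≠ A ω) True) * Real.log (Fintype.card α) := by
    simp only [mul_add, Finset.sum_add_distrib, ← Finset.sum_mul, hP1, one_mul, ← mul_assoc]
    congr 2
    unfold law
    refine Finset.sum_congr rfl fun ω _ => ?_
    by_cases h' : g (B ω) = A ω <;> simp [h']
  linarith

end Law

end InfoTheory

/-! ### Product laws and resampling of coordinates. -/

namespace InfoTheory

section ProductLaw

variable {ι : Type*} [Fintype ι] {Z : ι → Type*}

/-- The product mass function. -/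
def prodMass (u : ∀ i, Z i → ℝ) (x : ∀ i, Z i) : ℝ := ∏ i, u i (x i)

lemma prodMass_nonneg {u : ∀ i, Z i → ℝ} (hu : ∀ i z, 0 ≤ u i z) (x : ∀ i, Z i) :
    0 ≤ prodMass u x := Finset.prod_nonneg fun i _ => hu i _

lemma ne_zero_of_prodMass_ne_zero {u : ∀ i, Z i → ℝ} {x : ∀ i, Z i} (h : prodMass u x ≠ 0)
    (i : ι) : u i (x i) ≠ 0 := fun h' => h (Finset.prod_eq_zero (Finset.mem_univ i) h')

variable [DecidableEq ι] [∀ i, Fintype (Z i)]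

lemma sum_prodMass (u : ∀ i, Z i → ℝ) : ∑ x, prodMass u x = ∏ i, ∑ z, u i z := by
  simp only [prodMass]
  rw [Finset.prod_univ_sum, Fintype.piFinset_univ]

lemma sum_prodMass_eq_one {u : ∀ i, Z i → ℝ} (hu : ∀ i, ∑ z, u i z = 1) :
    ∑ x, prodMass u x = 1 := by
  rw [sum_prodMass]; simp [hu]

/-- The law of a coordinatewise function under a product mass function is a product. -/
lemma law_prodMass {B : ι → Type*} (u : ∀ i, Z i → ℝ) (φ : ∀ i, Z i → B i) (b : ∀ i, B i) :
    law (prodMass u) (fun x i => φ i (x i)) b = prodMass (fun i => law (u i) (φ i)) b := by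
  classical
  simp only [prodMass, law]
  rw [Finset.prod_univ_sum, Fintype.piFinset_univ]
  refine Finset.sum_congr rfl fun x _ => ?_
  split_ifs with h
  · refine Finset.prod_congr rfl fun i _ => ?_
    rw [if_pos (congrFun h i)]
  · obtain ⟨i, hi⟩ : ∃ i, φ i (x i) ≠ b i := by
      by_contra! h'
      exact h (funext h')
    exact (Finset.prod_eq_zero (Finset.mem_univ i) (if_neg hi)).symm

lemma sum_prodMass_comp {B : ι → Type*} [∀ i, Fintype (B i)] (u : ∀ i, Z i → ℝ)
    (φ : ∀ i, Z i → B i) (F : (∀ i, B i) → ℝ) :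
    ∑ x, prodMass u x * F (fun i => φ i (x i)) =
      ∑ b, prodMass (fun i => law (u i) (φ i)) b * F b := by
  rw [← sum_law_mul (prodMass u) (fun x i => φ i (x i)) F]
  simp only [law_prodMass]

lemma law_prodMass_restrict {u : ∀ i, Z i → ℝ} (hu : ∀ i, ∑ z, u i z = 1) (A : Finset ι)
    (x : ∀ i, Z i) :
    law (prodMass u) A.restrict (A.restrict x) = ∏ i ∈ A, u i (x i) := by
  classical
  have : law (prodMass u) A.restrict (A.restrict x) =
      ∑ y : ∀ i, Z i, ∏ i, (if i ∈ A → y i = x i then u i (y i) else 0) := by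
    unfold law
    refine Finset.sum_congr rfl fun y _ => ?_
    split_ifs with h
    · refine Finset.prod_congr rfl fun i _ => ?_
      rw [if_pos]
      intro hi
      exact congrFun h ⟨i, hi⟩
    · obtain ⟨i, hi⟩ : ∃ i, ¬ (i ∈ A → y i = x i) := by
        by_contra! h'
        exact h (funext fun i => h' i.1 i.2)
      exact (Finset.prod_eq_zero (Finset.mem_univ i) (if_neg hi)).symm
  rw [this]
  have h2 := Finset.prod_univ_sum (fun i => (Finset.univ : Finset (Z i)))
    (fun i z => if i ∈ A → z = x i then u i z else 0)
  rw [Fintype.piFinset_univ] at h2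
  rw [← h2, ← Finset.prod_subset (Finset.subset_univ A)]
  · refine Finset.prod_congr rfl fun i hi => ?_
    simp [hi]
  · intro i _ hi
    simp [hi, hu]

/-- Two independent copies may exchange any set of coordinates. -/
lemma sum_prodMass_swap (u : ∀ i, Z i → ℝ) (S : Finset ι) (F : (∀ i, Z i) → (∀ i, Z i) → ℝ) :
    ∑ x, ∑ y, prodMass u x * prodMass u y * F x y =
      ∑ x, ∑ y, prodMass u x * prodMass u y * F (S.piecewise y x) (S.piecewise x y) := by
  let e : (∀ i, Z i) × (∀ i, Z i) ≃ (∀ i, Z i) × (∀ i, Z i) :=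
    { toFun := fun q => (S.piecewise q.2 q.1, S.piecewise q.1 q.2)
      invFun := fun q => (S.piecewise q.2 q.1, S.piecewise q.1 q.2)
      left_inv := fun q => by
        ext i <;> by_cases h : i ∈ S <;> simp [h]
      right_inv := fun q => by
        ext i <;> by_cases h : i ∈ S <;> simp [h] }
  rw [← Fintype.sum_prod_type', ← Fintype.sum_prod_type', ← e.sum_comp]
  refine Finset.sum_congr rfl fun q _ => ?_
  congr 1
  simp only [prodMass, ← Finset.prod_mul_distrib, e, Equiv.coe_fn_mk]
  refine Finset.prod_congr rfl fun i _ => ?_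
  by_cases h : i ∈ S <;> simp [h, mul_comm]

/-- The average of `F` when the coordinates in `S` are resampled. -/
def partialAvg (u : ∀ i, Z i → ℝ) (S : Finset ι) (F : (∀ i, Z i) → ℝ) (x : ∀ i, Z i) : ℝ :=
  ∑ y, prodMass u y * F (S.piecewise y x)

/-- Resampling is self-adjoint. -/
lemma sum_prodMass_partialAvg_mul {u : ∀ i, Z i → ℝ} (hu : ∀ i, ∑ z, u i z = 1) (S : Finset ι)
    (F G : (∀ i, Z i) → ℝ) (hG : ∀ x y, G (S.piecewise y x) = G x) :
    ∑ x, prodMass u x * (partialAvg u S F x * G x) = ∑ x, prodMass u x * (F x * G x) := by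
  have h := sum_prodMass_swap u S (fun x _ => F x * G x)
  have h1 : ∑ x, ∑ y, prodMass u x * prodMass u y * (F x * G x) =
      ∑ x, prodMass u x * (F x * G x) := by
    refine Finset.sum_congr rfl fun x _ => ?_
    rw [← Finset.sum_mul, ← Finset.mul_sum, sum_prodMass_eq_one hu, mul_one]
  rw [← h1, h]
  refine Finset.sum_congr rfl fun x _ => ?_
  rw [partialAvg, Finset.sum_mul, Finset.mul_sum]
  refine Finset.sum_congr rfl fun y _ => ?_
  rw [hG]; ring

lemma sum_prodMass_partialAvg {u : ∀ i, Z i → ℝ} (hu : ∀ i, ∑ z, u i z = 1) (S : Finset ι)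
    (F : (∀ i, Z i) → ℝ) : ∑ x, prodMass u x * partialAvg u S F x = ∑ x, prodMass u x * F x := by
  simpa using sum_prodMass_partialAvg_mul hu S F (fun _ => 1) (fun _ _ => rfl)

lemma piecewise_piecewise_same {ι : Type*} [DecidableEq ι] {Z : ι → Type*} (S : Finset ι) (x y z : ∀ i, Z i) :
    S.piecewise z (S.piecewise y x) = S.piecewise z x := by
  ext i; by_cases h : i ∈ S <;> simp [h]

lemma partialAvg_piecewise (u : ∀ i, Z i → ℝ) (S : Finset ι) (F : (∀ i, Z i) → ℝ)
    (x y : ∀ i, Z i) : partialAvg u S F (S.piecewise y x) = partialAvg u S F x := by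
  simp only [partialAvg, piecewise_piecewise_same]

lemma partialAvg_empty {u : ∀ i, Z i → ℝ} (hu : ∀ i, ∑ z, u i z = 1) (F : (∀ i, Z i) → ℝ)
    (x : ∀ i, Z i) : partialAvg u ∅ F x = F x := by
  simp [partialAvg, ← Finset.sum_mul, sum_prodMass_eq_one hu]

lemma partialAvg_nonneg {u : ∀ i, Z i → ℝ} (hu : ∀ i z, 0 ≤ u i z) (S : Finset ι)
    {F : (∀ i, Z i) → ℝ} (hF : ∀ x, 0 ≤ F x) (x : ∀ i, Z i) : 0 ≤ partialAvg u S F x :=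
  Finset.sum_nonneg fun _ _ => mul_nonneg (prodMass_nonneg hu _) (hF _)

lemma partialAvg_ne_zero {u : ∀ i, Z i → ℝ} (hu : ∀ i z, 0 ≤ u i z) (S : Finset ι)
    {F : (∀ i, Z i) → ℝ} (hF : ∀ x, 0 ≤ F x) {x y : ∀ i, Z i} (h : prodMass u y ≠ 0)
    (hy : F (S.piecewise y x) ≠ 0) : partialAvg u S F x ≠ 0 := by
  refine ne_of_gt (lt_of_lt_of_le ?_ (Finset.single_le_sum
    (f := fun y => prodMass u y * F (S.piecewise y x))
    (fun y _ => mul_nonneg (prodMass_nonneg hu y) (hF _)) (Finset.mem_univ y)))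
  exact lt_of_le_of_ne (mul_nonneg (prodMass_nonneg hu y) (hF _)) (mul_ne_zero h hy).symm

lemma partialAvg_self_ne_zero {u : ∀ i, Z i → ℝ} (hu : ∀ i z, 0 ≤ u i z) (S : Finset ι)
    {F : (∀ i, Z i) → ℝ} (hF : ∀ x, 0 ≤ F x) {x : ∀ i, Z i} (h : prodMass u x ≠ 0)
    (hx : F x ≠ 0) : partialAvg u S F x ≠ 0 :=
  partialAvg_ne_zero hu S hF h (by rwa [Finset.piecewise_same])

lemma partialAvg_comp {B : ι → Type*} [∀ i, Fintype (B i)] (u : ∀ i, Z i → ℝ)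
    (φ : ∀ i, Z i → B i) (S : Finset ι) (F : (∀ i, B i) → ℝ) (x : ∀ i, Z i) :
    partialAvg u S (fun x => F (fun i => φ i (x i))) x =
      partialAvg (fun i => law (u i) (φ i)) S F (fun i => φ i (x i)) := by
  unfold partialAvg
  rw [← sum_prodMass_comp u φ (fun b => F (S.piecewise b (fun i => φ i (x i))))]
  refine Finset.sum_congr rfl fun y _ => ?_
  congr 1
  refine congrArg F (funext fun i => ?_)
  by_cases h : i ∈ S <;> simp [h]

end ProductLaw

/-! ### Output entropies of a channel with independent inputs. -/

section OutputEntropy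

variable {ι : Type*} [Fintype ι] [DecidableEq ι] {Z : ι → Type*} [∀ i, Fintype (Z i)]
  {O B : Type*} [Fintype O] [Fintype B]

/-- For independent inputs with laws `u i` and a channel `U`, the entropy in nats of the output
given the inputs outside `S`. -/
noncomputable def outEntropy (u : ∀ i, Z i → ℝ) (U : (∀ i, Z i) → B → ℝ) (S : Finset ι) : ℝ :=
  ∑ x, prodMass u x * ∑ b, Real.negMulLog (partialAvg u S (U · b) x)

/-- The logarithm of a resampled function is unchanged by resampling, so self-adjointness removes
the average from the other factor. The result is an expectation under the true joint law, as needed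
for the chain rule and for the mean of the information density. -/
lemma outEntropy_eq {u : ∀ i, Z i → ℝ} (hu : ∀ i, ∑ z, u i z = 1) (U : (∀ i, Z i) → B → ℝ)
    (S : Finset ι) : outEntropy u U S =
      -∑ x, prodMass u x * ∑ b, U x b * Real.log (partialAvg u S (U · b) x) := by
  have h : ∀ b, ∑ x, prodMass u x * (partialAvg u S (U · b) x *
      Real.log (partialAvg u S (U · b) x)) =
      ∑ x, prodMass u x * (U x b * Real.log (partialAvg u S (U · b) x)) := fun b =>
    sum_prodMass_partialAvg_mul hu S _ _ (fun x y => by rw [partialAvg_piecewise])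
  unfold outEntropy
  simp only [Finset.mul_sum, Real.negMulLog]
  rw [Finset.sum_comm, Finset.sum_comm (f := fun x b => prodMass u x * (U x b * _)),
    ← Finset.sum_neg_distrib]
  refine Finset.sum_congr rfl fun b _ => ?_
  rw [← h b, ← Finset.sum_neg_distrib]
  refine Finset.sum_congr rfl fun x _ => ?_
  ring

/-- The channel sees its inputs only through `φ`. In the converse this passes from uniform messages
to the letters of their codewords. -/
lemma outEntropy_comp {C : ι → Type*} [∀ i, Fintype (C i)] (u : ∀ i, Z i → ℝ)
    (φ : ∀ i, Z i → C i) (U : (∀ i, C i) → B → ℝ) (S : Finset ι) :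
    outEntropy u (fun x => U (fun i => φ i (x i))) S =
      outEntropy (fun i => law (u i) (φ i)) U S := by
  unfold outEntropy
  rw [← sum_prodMass_comp u φ (fun c => ∑ b, Real.negMulLog
    (partialAvg (fun i => law (u i) (φ i)) S (U · b) c))]
  refine Finset.sum_congr rfl fun x _ => ?_
  congr 1
  refine Finset.sum_congr rfl fun b _ => ?_
  rw [← partialAvg_comp u φ S (fun c => U c b)]

/-- The joint mass function of independent inputs and the channel output. -/
def prodJoint (u : ∀ i, Z i → ℝ) (V : (∀ i, Z i) → O → ℝ) (ω : (∀ i, Z i) × O) : ℝ :=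
  prodMass u ω.1 * V ω.1 ω.2

lemma prodJoint_nonneg {u : ∀ i, Z i → ℝ} (hu : ∀ i z, 0 ≤ u i z) {V : (∀ i, Z i) → O → ℝ}
    (hV : ∀ x o, 0 ≤ V x o) (ω : (∀ i, Z i) × O) : 0 ≤ prodJoint u V ω :=
  mul_nonneg (prodMass_nonneg hu _) (hV _ _)

lemma sum_prodJoint_mul (u : ∀ i, Z i → ℝ) {V : (∀ i, Z i) → O → ℝ} (hV : ∀ x, ∑ o, V x o = 1)
    (F : (∀ i, Z i) → ℝ) : ∑ ω, prodJoint u V ω * F ω.1 = ∑ x, prodMass u x * F x := by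
  rw [Fintype.sum_prod_type]
  refine Finset.sum_congr rfl fun x _ => ?_
  simp only [prodJoint]
  rw [← Finset.sum_mul, ← Finset.mul_sum, hV, mul_one]

lemma sum_prodJoint {u : ∀ i, Z i → ℝ} (hu : ∀ i, ∑ z, u i z = 1)
    {V : (∀ i, Z i) → O → ℝ} (hV : ∀ x, ∑ o, V x o = 1) : ∑ ω, prodJoint u V ω = 1 := by
  have := sum_prodJoint_mul u hV (fun _ => 1)
  simpa [sum_prodMass_eq_one hu] using this

lemma law_prodJoint_fst (u : ∀ i, Z i → ℝ) {V : (∀ i, Z i) → O → ℝ} (hV : ∀ x, ∑ o, V x o = 1)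
    {α : Type*} (f : (∀ i, Z i) → α) (a : α) :
    law (prodJoint u V) (fun ω => f ω.1) a = law (prodMass u) f a := by
  classical
  have := sum_prodJoint_mul u hV (fun x => if f x = a then 1 else 0)
  simp only [mul_ite, mul_one, mul_zero] at this
  unfold law
  convert this using 2

/-- The indicator that the inputs in `A` have given values ignores the coordinates outside `A`.
Self-adjointness of resampling therefore factors the joint law as `p(x_A) p(y | x_A)`. -/
lemma law_prodJoint {u : ∀ i, Z i → ℝ} (hu : ∀ i, ∑ z, u i z = 1) (V : (∀ i, Z i) → O → ℝ)
    (g : O → B) (A : Finset ι) (x : ∀ i, Z i) (b : B) :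
    law (prodJoint u V) (fun ω => (A.restrict ω.1, g ω.2)) (A.restrict x, b) =
      (∏ i ∈ A, u i (x i)) * partialAvg u Aᶜ (fun x => law (V x) g b) x := by
  classical
  have h := sum_prodMass_partialAvg_mul hu Aᶜ (fun x => law (V x) g b)
    (fun y => if A.restrict y = A.restrict x then 1 else 0) (by
      intro y z
      have : A.restrict (Aᶜ.piecewise z y) = A.restrict y := by
        ext i; simp
      rw [this])
  rw [← law_prodMass_restrict hu A x]
  have h1 : law (prodJoint u V) (fun ω => (A.restrict ω.1, g ω.2)) (A.restrict x, b) =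
      ∑ y, prodMass u y * (law (V y) g b * if A.restrict y = A.restrict x then 1 else 0) := by
    unfold law
    rw [Fintype.sum_prod_type]
    refine Finset.sum_congr rfl fun y _ => ?_
    rw [Finset.sum_mul, Finset.mul_sum]
    refine Finset.sum_congr rfl fun o _ => ?_
    simp only [prodJoint, Prod.mk.injEq]
    by_cases h1 : A.restrict y = A.restrict x <;> by_cases h2 : g o = b <;> simp [h1, h2]
  rw [h1, ← h, law, Finset.sum_mul]
  refine Finset.sum_congr rfl fun y _ => ?_
  split_ifs with h2
  · rw [mul_one]
    have : ∀ z, Aᶜ.piecewise z y = Aᶜ.piecewise z x := by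
      intro z
      ext i
      by_cases hi : i ∈ A
      · simpa [hi] using congrFun h2 ⟨i, hi⟩
      · simp [hi]
    simp only [partialAvg, this]
  · simp

lemma natEntropy_restrict {u : ∀ i, Z i → ℝ} (hu : ∀ i, ∑ z, u i z = 1)
    {V : (∀ i, Z i) → O → ℝ} (hV : ∀ x, ∑ o, V x o = 1) (A : Finset ι) :
    natEntropy (prodJoint u V) (fun ω => A.restrict ω.1) =
      ∑ i ∈ A, -∑ x, prodMass u x * Real.log (u i (x i)) := by
  unfold natEntropy
  rw [Finset.sum_neg_distrib, Finset.sum_comm]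
  congr 1
  have := sum_prodJoint_mul u hV (fun x => Real.log (∏ i ∈ A, u i (x i)))
  simp only [law_prodJoint_fst u hV, law_prodMass_restrict hu]
  rw [this]
  refine Finset.sum_congr rfl fun x _ => ?_
  by_cases h : prodMass u x = 0
  · simp [h]
  rw [Real.log_prod (fun i _ => ne_zero_of_prodMass_ne_zero h i), Finset.mul_sum]

/-- Chain rule: `H(X_A, Y) = H(X_A) + H(Y | X_A)` for independent inputs. -/
lemma natEntropy_restrict_output {u : ∀ i, Z i → ℝ} (hu0 : ∀ i z, 0 ≤ u i z)
    (hu : ∀ i, ∑ z, u i z = 1) {V : (∀ i, Z i) → O → ℝ} (hV0 : ∀ x o, 0 ≤ V x o)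
    (hV : ∀ x, ∑ o, V x o = 1) (g : O → B) (A : Finset ι) :
    natEntropy (prodJoint u V) (fun ω => (A.restrict ω.1, g ω.2)) =
      natEntropy (prodJoint u V) (fun ω => A.restrict ω.1) +
        outEntropy u (fun x b => law (V x) g b) Aᶜ := by
  rw [outEntropy_eq hu]
  unfold natEntropy
  rw [← neg_add]
  congr 1
  have h : ∑ x, prodMass u x * ∑ b, law (V x) g b *
      Real.log (partialAvg u Aᶜ (fun x => law (V x) g b) x) =
      ∑ ω, prodJoint u V ω *
        Real.log (partialAvg u Aᶜ (fun x => law (V x) g (g ω.2)) ω.1) := by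
    rw [Fintype.sum_prod_type]
    refine Finset.sum_congr rfl fun x _ => ?_
    rw [sum_law_mul (V x) g (fun b => Real.log (partialAvg u Aᶜ (fun x => law (V x) g b) x)),
      Finset.mul_sum]
    simp only [prodJoint, mul_assoc]
  rw [h, ← Finset.sum_add_distrib]
  refine Finset.sum_congr rfl fun ω _ => ?_
  by_cases h0 : prodJoint u V ω = 0
  · simp [h0]
  have h1 : prodMass u ω.1 ≠ 0 := left_ne_zero_of_mul h0
  have h2 : V ω.1 ω.2 ≠ 0 := right_ne_zero_of_mul h0
  rw [law_prodJoint hu, law_prodJoint_fst u hV, law_prodMass_restrict hu, Real.log_mul, mul_add]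
  · exact Finset.prod_ne_zero_iff.2 fun i _ => ne_zero_of_prodMass_ne_zero h1 i
  · exact partialAvg_self_ne_zero hu0 _ (fun x => law_nonneg (hV0 x) _ _) h1
      (law_self_pos (hV0 _) g h2).ne'

lemma law_id {O : Type*} [Fintype O] {P : O → ℝ} (o : O) : law P (fun o => o) o = P o := by
  classical
  simp [law]

/-- For independent inputs, `I(X_m; Y | X_A)` is at least `I(X_m; Y)`. -/
lemma outEntropy_insert_sub_ge {u : ∀ i, Z i → ℝ} (hu0 : ∀ i z, 0 ≤ u i z)
    (hu : ∀ i, ∑ z, u i z = 1) {U : (∀ i, Z i) → B → ℝ} (hU0 : ∀ x o, 0 ≤ U x o)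
    (hU : ∀ x, ∑ o, U x o = 1) {S : Finset ι} {m : ι} (hm : m ∉ S) :
    outEntropy u U Finset.univ - outEntropy u U {m}ᶜ ≤
      outEntropy u U (insert m S) - outEntropy u U S := by
  have key : ∀ A : Finset ι,
      natEntropy (prodJoint u U) (fun ω => (A.restrict ω.1, ω.2)) =
        ∑ i ∈ A, (-∑ x, prodMass u x * Real.log (u i (x i))) + outEntropy u U Aᶜ := by
    intro A
    have := natEntropy_restrict_output hu0 hu hU0 hU (fun b => b) A
    rw [natEntropy_restrict hu hU] at this
    simpa only [law_id] using this
  -- Submodularity is conditioned on the output, with the inputs outside `insert m S` against the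
  -- input `m`. By independence the input entropies are sums over users and cancel, so only output
  -- entropies remain.
  have h := natEntropy_submodular (prodJoint_nonneg hu0 hU0)
    (fun ω => (insert m S)ᶜ.restrict ω.1) (fun ω => ({m} : Finset ι).restrict ω.1) (fun ω => ω.2)
  have e1 : natEntropy (prodJoint u U) (fun ω => ((insert m S)ᶜ.restrict ω.1,
      ({m} : Finset ι).restrict ω.1, ω.2)) =
      natEntropy (prodJoint u U) (fun ω => (Sᶜ.restrict ω.1, ω.2)) := by
    refine natEntropy_congr fun ω ω' => ?_
    simp only [Prod.mk.injEq, funext_iff, Finset.restrict, Subtype.forall, ← and_assoc]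
    refine and_congr_left fun _ => ⟨fun hh i hi => ?_, fun hh => ⟨fun i hi => hh i ?_,
      fun i hi => hh i ?_⟩⟩
    · by_cases e : i = m
      · exact hh.2 i (by simp [e])
      · exact hh.1 i (by simpa [e] using hi)
    · simp at hi ⊢; exact hi.2
    · simp at hi ⊢; exact hi ▸ hm
  have e2 : natEntropy (prodJoint u U) (fun ω => ω.2) =
      natEntropy (prodJoint u U) (fun ω => ((∅ : Finset ι).restrict ω.1, ω.2)) := by
    refine natEntropy_congr fun ω ω' => ?_
    simp [Prod.ext_iff, funext_iff]
  rw [e1, e2, key, key, key, key] at h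
  have e3 : Sᶜ = insert m (insert m S)ᶜ := by
    ext i
    by_cases e : i = m
    · simp [e, hm]
    · simp [e]
  rw [compl_compl, compl_compl, Finset.compl_empty, e3, Finset.sum_insert (by simp)] at h
  simp only [Finset.sum_singleton, Finset.sum_empty] at h
  linarith

end OutputEntropy

end InfoTheory

/-! ### Mutual informations of the interference channel as output entropies. -/

namespace DMIC

open InfoTheory

variable {K : ℕ} {X Y : Fin K → Type*} [∀ i, Fintype (X i)] [∀ i, Fintype (Y i)]

/-- The channel from the inputs to the output at receiver `j`. -/
noncomputable def outLaw (W : Channel K X Y) (j : Fin K) (x : ∀ i, X i) (b : Y j) : ℝ :=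
  law (W x).1 (fun y => y j) b

lemma outLaw_nonneg (W : Channel K X Y) (j : Fin K) (x : ∀ i, X i) (b : Y j) :
    0 ≤ outLaw W j x b := law_nonneg (W x).2.1 _ _

lemma sum_outLaw (W : Channel K X Y) (j : Fin K) (x : ∀ i, X i) : ∑ b, outLaw W j x b = 1 := by
  unfold outLaw
  rw [sum_law]; exact (W x).2.2

/-- The entropy in nats of the output at `j` given the inputs outside `S`. -/
noncomputable def rcvEntropy (W : Channel K X Y) (p : ∀ i, stdSimplex ℝ (X i)) (j : Fin K)
    (S : Finset (Fin K)) : ℝ :=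
  outEntropy (fun i => (p i).1) (outLaw W j) S

/-- The mutual information in nats between the inputs in `S` and the output at `j`, given the
other inputs. -/
noncomputable def rcvInfo (W : Channel K X Y) (p : ∀ i, stdSimplex ℝ (X i)) (j : Fin K)
    (S : Finset (Fin K)) : ℝ :=
  rcvEntropy W p j S - rcvEntropy W p j ∅

lemma joint_eq_prodJoint (W : Channel K X Y) (p : ∀ i, stdSimplex ℝ (X i)) :
    joint W p = prodJoint (fun i => (p i).1) (fun x => (W x).1) := rfl

lemma natEntropy_joint (W : Channel K X Y) (p : ∀ i, stdSimplex ℝ (X i)) (j : Fin K)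
    (A : Finset (Fin K)) :
    natEntropy (joint W p) (fun ω => (A.restrict ω.1, ω.2 j)) =
      natEntropy (joint W p) (fun ω => A.restrict ω.1) + rcvEntropy W p j Aᶜ :=
  natEntropy_restrict_output (fun i => (p i).2.1) (fun i => (p i).2.2) (fun x => (W x).2.1)
    (fun x => (W x).2.2) (fun y => y j) A

/-- Since `a` and the inputs in `A` together determine all inputs, the pair can be replaced by the
full input vector, after which the input entropies cancel. Leaving `a` general covers single inputs,
pairs and the whole vector. -/
lemma condMutualInfo_joint (W : Channel K X Y) (p : ∀ i, stdSimplex ℝ (X i)) (j : Fin K)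
    (A : Finset (Fin K)) {α : Type*} [Fintype α] (a : (∀ i, X i) → α)
    (ha : ∀ x x', a x = a x' → A.restrict x = A.restrict x' → x = x') :
    condMutualInfo (joint W p) (fun ω => a ω.1) (fun ω => ω.2 j) (fun ω => A.restrict ω.1) =
      rcvInfo W p j Aᶜ / Real.log 2 := by
  have h1 := natEntropy_joint W p j A
  have h2 := natEntropy_joint W p j Finset.univ
  have e1 : natEntropy (joint W p) (fun ω => (a ω.1, A.restrict ω.1)) =
      natEntropy (joint W p) (fun ω => (Finset.univ : Finset (Fin K)).restrict ω.1) := by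
    refine natEntropy_congr fun ω ω' => ?_
    rw [Prod.mk.injEq]
    refine ⟨fun h => by rw [ha _ _ h.1 h.2], fun h => ?_⟩
    have : ω.1 = ω'.1 := funext fun i => congrFun h ⟨i, Finset.mem_univ i⟩
    simp [this]
  have e2 : natEntropy (joint W p) (fun ω => (a ω.1, ω.2 j, A.restrict ω.1)) =
      natEntropy (joint W p) (fun ω => ((Finset.univ : Finset (Fin K)).restrict ω.1, ω.2 j)) := by
    refine natEntropy_congr fun ω ω' => ?_
    simp only [Prod.mk.injEq]
    refine ⟨fun h => by rw [ha _ _ h.1 h.2.2, h.2.1]; simp, fun h => ?_⟩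
    have : ω.1 = ω'.1 := funext fun i => congrFun h.1 ⟨i, Finset.mem_univ i⟩
    simp [this, h.2]
  have e3 : natEntropy (joint W p) (fun ω => (ω.2 j, A.restrict ω.1)) =
      natEntropy (joint W p) (fun ω => (A.restrict ω.1, ω.2 j)) :=
    natEntropy_congr fun ω ω' => by simp only [Prod.mk.injEq]; exact and_comm
  rw [Finset.compl_univ] at h2
  simp only [condMutualInfo, condEntropy, entropy_eq, e1, e2, e3, h1, h2, rcvInfo]
  ring

lemma mutualInfo_joint (W : Channel K X Y) (p : ∀ i, stdSimplex ℝ (X i)) (m j : Fin K) :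
    mutualInfo (joint W p) (fun ω => ω.1 m) (fun ω => ω.2 j) =
      (rcvEntropy W p j Finset.univ - rcvEntropy W p j {m}ᶜ) / Real.log 2 := by
  have h1 := natEntropy_joint W p j ∅
  have h2 := natEntropy_joint W p j {m}
  have h3 : natEntropy (joint W p) (fun ω => (∅ : Finset (Fin K)).restrict ω.1) = 0 := by
    have := natEntropy_restrict (u := fun i => (p i).1) (V := fun x => (W x).1)
      (fun i => (p i).2.2) (fun x => (W x).2.2) ∅
    rw [joint_eq_prodJoint, this, Finset.sum_empty]
  have e1 : natEntropy (joint W p) (fun ω => (ω.1 m, ω.2 j)) =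
      natEntropy (joint W p) (fun ω => (({m} : Finset (Fin K)).restrict ω.1, ω.2 j)) := by
    refine natEntropy_congr fun ω ω' => ?_
    simp [Prod.ext_iff, funext_iff]
  have e2 : natEntropy (joint W p) (fun ω => ω.1 m) =
      natEntropy (joint W p) (fun ω => ({m} : Finset (Fin K)).restrict ω.1) := by
    refine natEntropy_congr fun ω ω' => ?_
    simp [funext_iff]
  have e3 : natEntropy (joint W p) (fun ω => ω.2 j) =
      natEntropy (joint W p) (fun ω => ((∅ : Finset (Fin K)).restrict ω.1, ω.2 j)) := by
    refine natEntropy_congr fun ω ω' => ?_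
    simp [Prod.ext_iff, funext_iff]
  rw [Finset.compl_empty] at h1
  simp only [mutualInfo, condEntropy, entropy_eq, e1, e2, e3, h1, h2, h3]
  ring

lemma eq_of_restrict_compl_singleton {m : Fin K} (x x' : ∀ i, X i) (h : x m = x' m)
    (h' : ({m}ᶜ : Finset (Fin K)).restrict x = ({m}ᶜ : Finset (Fin K)).restrict x') : x = x' := by
  funext i
  by_cases e : i = m
  · subst e; exact h
  · exact congrFun h' ⟨i, by simpa using e⟩

lemma eq_of_restrict_compl_pair {j m : Fin K} (x x' : ∀ i, X i) (h : (x j, x m) = (x' j, x' m))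
    (h' : ({j, m}ᶜ : Finset (Fin K)).restrict x = ({j, m}ᶜ : Finset (Fin K)).restrict x') :
    x = x' := by
  rw [Prod.mk.injEq] at h
  funext i
  by_cases e : i = j
  · subst e; exact h.1
  by_cases e' : i = m
  · subst e'; exact h.2
  · exact congrFun h' ⟨i, by simp [e, e']⟩

lemma log_two_pos : 0 < Real.log 2 := Real.log_pos (by norm_num)

lemma IsStrong.rcvInfo_le {W : Channel K X Y} {m j : Fin K} (h : IsStrong W m j)
    (p : ∀ i, stdSimplex ℝ (X i)) : rcvInfo W p m {m} ≤ rcvInfo W p j {m} := by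
  have := h p
  rw [condMutualInfo_joint W p m {m}ᶜ (fun x => x m) eq_of_restrict_compl_singleton,
    condMutualInfo_joint W p j {m}ᶜ (fun x => x m) eq_of_restrict_compl_singleton,
    compl_compl, div_le_div_iff_of_pos_right log_two_pos] at this
  exact this

/-- The increment on the right is the information about `X_m` at `j` given the inputs outside
`insert m S`. Conditioning on independent inputs cannot lower it below `I[X_m; Y_j]`. This allows
very strong interferers to join the decoded set one at a time. -/
lemma IsVeryStrong.rcvInfo_le {W : Channel K X Y} {m j : Fin K} (h : IsVeryStrong W m j)
    (p : ∀ i, stdSimplex ℝ (X i)) {S : Finset (Fin K)} (hm : m ∉ S) :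
    rcvInfo W p m {m} ≤ rcvInfo W p j (insert m S) - rcvInfo W p j S := by
  have := h p
  rw [condMutualInfo_joint W p m {m}ᶜ (fun x => x m) eq_of_restrict_compl_singleton,
    mutualInfo_joint, compl_compl, ge_iff_le, div_le_div_iff_of_pos_right log_two_pos] at this
  refine this.trans ?_
  have := outEntropy_insert_sub_ge (fun i => (p i).2.1) (fun i => (p i).2.2) (outLaw_nonneg W j)
    (sum_outLaw W j) hm
  unfold rcvInfo rcvEntropy
  linarith

/-! ### Averaging over the time-sharing variable. -/

section TimeSharing

variable {s : ℕ}

lemma jointTS_eq (W : Channel K X Y) (pQ : stdSimplex ℝ (Fin s))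
    (p : ∀ i, Fin s → stdSimplex ℝ (X i)) (ω : Fin s × (∀ i, X i) × (∀ i, Y i)) :
    jointTS W pQ p ω = pQ.1 ω.1 * joint W (fun i => p i ω.1) ω.2 := by
  simp only [jointTS, joint, mul_assoc]

lemma natEntropy_jointTS (W : Channel K X Y) (pQ : stdSimplex ℝ (Fin s))
    (p : ∀ i, Fin s → stdSimplex ℝ (X i)) {α : Type*} (f : (∀ i, X i) × (∀ i, Y i) → α) :
    natEntropy (jointTS W pQ p) (fun ω => (f ω.2, ω.1)) =
      -∑ q, pQ.1 q * Real.log (pQ.1 q) +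
        ∑ q, pQ.1 q * natEntropy (joint W (fun i => p i q)) f := by
  classical
  have hlaw : ∀ ω : Fin s × (∀ i, X i) × (∀ i, Y i),
      law (jointTS W pQ p) (fun ω => (f ω.2, ω.1)) (f ω.2, ω.1) =
        pQ.1 ω.1 * law (joint W (fun i => p i ω.1)) f (f ω.2) := by
    intro ω
    unfold law
    rw [Fintype.sum_prod_type, Finset.sum_eq_single ω.1, Finset.mul_sum]
    · refine Finset.sum_congr rfl fun ω' _ => ?_
      by_cases h : f ω' = f ω.2 <;> simp [h, jointTS_eq]
    · intro q _ hq
      simp [hq]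
    · simp
  have hJ0 : ∀ q ω, 0 ≤ joint W (fun i => p i q) ω := fun q =>
    prodJoint_nonneg (fun i => (p i q).2.1) (fun x => (W x).2.1)
  have hJ : ∀ q, ∑ ω, joint W (fun i => p i q) ω = 1 := fun q =>
    sum_prodJoint (fun i => (p i q).2.2) (fun x => (W x).2.2)
  unfold natEntropy
  rw [Fintype.sum_prod_type, ← Finset.sum_neg_distrib, ← Finset.sum_neg_distrib,
    ← Finset.sum_add_distrib]
  refine Finset.sum_congr rfl fun q _ => ?_
  by_cases hq : pQ.1 q = 0
  · simp [jointTS_eq, hq]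
  have : ∀ ω, jointTS W pQ p (q, ω) *
      Real.log (law (jointTS W pQ p) (fun ω => (f ω.2, ω.1)) (f ω, q)) =
      joint W (fun i => p i q) ω * (pQ.1 q * Real.log (pQ.1 q)) + pQ.1 q *
        (joint W (fun i => p i q) ω * Real.log (law (joint W (fun i => p i q)) f (f ω))) := by
    intro ω
    rw [hlaw (q, ω), jointTS_eq]
    by_cases hω : joint W (fun i => p i q) ω = 0
    · simp [hω]
    rw [Real.log_mul hq (law_self_pos (hJ0 q) f hω).ne']
    ring
  simp only [this]
  rw [Finset.sum_add_distrib, ← Finset.sum_mul, hJ, ← Finset.mul_sum]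
  ring

/-- Each of the four entropies involved is the entropy of `Q` plus an average over `q`, and the
entropy of `Q` cancels. -/
lemma condMutualInfo_jointTS (W : Channel K X Y) (pQ : stdSimplex ℝ (Fin s))
    (p : ∀ i, Fin s → stdSimplex ℝ (X i)) {α β γ : Type*} [Fintype α] [Fintype β] [Fintype γ]
    (a : (∀ i, X i) × (∀ i, Y i) → α) (b : (∀ i, X i) × (∀ i, Y i) → β)
    (c : (∀ i, X i) × (∀ i, Y i) → γ) :
    condMutualInfo (jointTS W pQ p) (fun ω => a ω.2) (fun ω => b ω.2) (fun ω => (c ω.2, ω.1)) =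
      ∑ q, pQ.1 q * condMutualInfo (joint W (fun i => p i q)) a b c := by
  have e1 : natEntropy (jointTS W pQ p) (fun ω => (a ω.2, c ω.2, ω.1)) =
      natEntropy (jointTS W pQ p) (fun ω => ((a ω.2, c ω.2), ω.1)) :=
    natEntropy_congr fun ω ω' => by simp only [Prod.mk.injEq]; tauto
  have e2 : natEntropy (jointTS W pQ p) (fun ω => (b ω.2, c ω.2, ω.1)) =
      natEntropy (jointTS W pQ p) (fun ω => ((b ω.2, c ω.2), ω.1)) :=
    natEntropy_congr fun ω ω' => by simp only [Prod.mk.injEq]; tauto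
  have e3 : natEntropy (jointTS W pQ p) (fun ω => (a ω.2, b ω.2, c ω.2, ω.1)) =
      natEntropy (jointTS W pQ p) (fun ω => ((a ω.2, b ω.2, c ω.2), ω.1)) :=
    natEntropy_congr fun ω ω' => by simp only [Prod.mk.injEq]; tauto
  simp only [condMutualInfo, condEntropy, entropy_eq, e1, e2, e3]
  rw [natEntropy_jointTS W pQ p (fun ω => (a ω, c ω)), natEntropy_jointTS W pQ p c,
    natEntropy_jointTS W pQ p (fun ω => (a ω, b ω, c ω)),
    natEntropy_jointTS W pQ p (fun ω => (b ω, c ω))]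
  simp only [mul_sub, mul_div_assoc', Finset.sum_sub_distrib, ← Finset.sum_div]
  ring

/-- Membership in the rate region, in nats. -/
lemma mem_rateRegion_iff (W : Channel K X Y) (l : Fin K → Fin K) (N : ℕ) (R : Fin K → ℝ) :
    R ∈ rateRegion W l N ↔ (∀ i, 0 ≤ R i) ∧
      ∃ s ≤ N, ∃ (pQ : stdSimplex ℝ (Fin s)) (p : ∀ i, Fin s → stdSimplex ℝ (X i)),
        (∀ i, R i * Real.log 2 ≤ ∑ q, pQ.1 q * rcvInfo W (fun i => p i q) i {i}) ∧
        (∀ j, (R j + R (l j)) * Real.log 2 ≤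
          ∑ q, pQ.1 q * rcvInfo W (fun i => p i q) j {j, l j}) := by
  have h1 : ∀ (s : ℕ) (pQ : stdSimplex ℝ (Fin s)) (p : ∀ i, Fin s → stdSimplex ℝ (X i)) (i),
      condMutualInfo (jointTS W pQ p) (fun ω => ω.2.1 i) (fun ω => ω.2.2 i)
        (fun ω => (Finset.restrict {i}ᶜ ω.2.1, ω.1)) =
      (∑ q, pQ.1 q * rcvInfo W (fun i => p i q) i {i}) / Real.log 2 := by
    intro s pQ p i
    rw [condMutualInfo_jointTS W pQ p (fun ω => ω.1 i) (fun ω => ω.2 i)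
      (fun ω => Finset.restrict {i}ᶜ ω.1), Finset.sum_div]
    refine Finset.sum_congr rfl fun q _ => ?_
    rw [condMutualInfo_joint W _ i {i}ᶜ (fun x => x i) eq_of_restrict_compl_singleton,
      compl_compl, mul_div_assoc]
  have h2 : ∀ (s : ℕ) (pQ : stdSimplex ℝ (Fin s)) (p : ∀ i, Fin s → stdSimplex ℝ (X i)) (j),
      condMutualInfo (jointTS W pQ p) (fun ω => (ω.2.1 j, ω.2.1 (l j))) (fun ω => ω.2.2 j)
        (fun ω => (Finset.restrict {j, l j}ᶜ ω.2.1, ω.1)) =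
      (∑ q, pQ.1 q * rcvInfo W (fun i => p i q) j {j, l j}) / Real.log 2 := by
    intro s pQ p j
    rw [condMutualInfo_jointTS W pQ p (fun ω => (ω.1 j, ω.1 (l j))) (fun ω => ω.2 j)
      (fun ω => Finset.restrict {j, l j}ᶜ ω.1), Finset.sum_div]
    refine Finset.sum_congr rfl fun q _ => ?_
    rw [condMutualInfo_joint W _ j {j, l j}ᶜ (fun x => (x j, x (l j))) eq_of_restrict_compl_pair,
      compl_compl, mul_div_assoc]
  simp only [rateRegion, Set.mem_ofPred_eq, h1, h2, le_div_iff₀ log_two_pos]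

end TimeSharing

/-! ### Compactness of the rate region and the cardinality of the time-sharing variable. -/

section Closed

lemma continuous_rcvEntropy (W : Channel K X Y) (j : Fin K) (S : Finset (Fin K)) :
    Continuous fun p : ∀ i, stdSimplex ℝ (X i) => rcvEntropy W p j S := by
  unfold rcvEntropy outEntropy partialAvg prodMass
  have h : ∀ (x : ∀ i, X i) (i : Fin K),
      Continuous fun p : ∀ i, stdSimplex ℝ (X i) => (p i).1 (x i) := fun x i =>
    (continuous_apply (x i)).comp (continuous_subtype_val.comp (continuous_apply i))
  refine continuous_finsetSum _ fun x _ => (continuous_finsetProd _ fun i _ => h x i).mul ?_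
  refine continuous_finsetSum _ fun b _ => Real.continuous_negMulLog.comp ?_
  exact continuous_finsetSum _ fun y _ =>
    (continuous_finsetProd _ fun i _ => h y i).mul continuous_const

lemma continuous_rcvInfo (W : Channel K X Y) (j : Fin K) (S : Finset (Fin K)) :
    Continuous fun p : ∀ i, stdSimplex ℝ (X i) => rcvInfo W p j S :=
  (continuous_rcvEntropy W j S).sub (continuous_rcvEntropy W j ∅)

/-- For fixed `s` the constraints are closed conditions on rates and distributions jointly, and
projecting along the compact space of distributions keeps closedness. The bound `N` makes the union
over `s` finite. -/
lemma isClosed_rateRegion (W : Channel K X Y) (l : Fin K → Fin K) (N : ℕ) :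
    IsClosed (rateRegion W l N) := by
  have e : rateRegion W l N = ⋃ s ∈ Finset.range (N + 1), Prod.fst ''
      {z : (Fin K → ℝ) × stdSimplex ℝ (Fin s) × (∀ i, Fin s → stdSimplex ℝ (X i)) |
        (∀ i, 0 ≤ z.1 i) ∧
        (∀ i, z.1 i * Real.log 2 ≤ ∑ q, z.2.1.1 q * rcvInfo W (fun i => z.2.2 i q) i {i}) ∧
        (∀ j, (z.1 j + z.1 (l j)) * Real.log 2 ≤
          ∑ q, z.2.1.1 q * rcvInfo W (fun i => z.2.2 i q) j {j, l j})} := by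
    ext R
    rw [mem_rateRegion_iff]
    simp only [Set.mem_iUnion, Set.mem_image, Set.mem_ofPred_eq, Finset.mem_range, exists_prop,
      Prod.exists, exists_and_right, exists_eq_right, Nat.lt_succ_iff]
    constructor
    · rintro ⟨h0, s, hs, pQ, p, h1, h2⟩
      exact ⟨s, hs, pQ, p, h0, h1, h2⟩
    · rintro ⟨s, hs, pQ, p, h0, h1, h2⟩
      exact ⟨h0, s, hs, pQ, p, h1, h2⟩
  rw [e]
  refine isClosed_biUnion_finset fun s _ => isClosedMap_fst_of_compactSpace _ ?_
  have hc : ∀ j S, Continuous fun z : (Fin K → ℝ) × stdSimplex ℝ (Fin s) ×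
      (∀ i, Fin s → stdSimplex ℝ (X i)) =>
        ∑ q, z.2.1.1 q * rcvInfo W (fun i => z.2.2 i q) j S := by
    intro j S
    refine continuous_finsetSum _ fun q _ => Continuous.mul ?_ ?_
    · exact (continuous_apply q).comp (continuous_subtype_val.comp (by fun_prop))
    · exact (continuous_rcvInfo W j S).comp (by fun_prop)
  simp only [Set.ofPred_and, Set.ofPred_forall]
  refine IsClosed.inter (isClosed_iInter fun i => isClosed_le (by fun_prop) (by fun_prop))
    (IsClosed.inter (isClosed_iInter fun i => isClosed_le (by fun_prop) (hc _ _))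
      (isClosed_iInter fun i => isClosed_le (by fun_prop) (hc _ _)))

/-- The vector of the mutual informations in nats that bound the rates and the sum rates. -/
noncomputable def infoVec (W : Channel K X Y) (l : Fin K → Fin K) (p : ∀ i, stdSimplex ℝ (X i)) :
    Fin K ⊕ Fin K → ℝ :=
  Sum.elim (fun i => rcvInfo W p i {i}) (fun j => rcvInfo W p j {j, l j})

/-- By Carathéodory's theorem `2 K + 1` values of the time-sharing variable suffice. -/
lemma mem_rateRegion_of_mem_convexHull {W : Channel K X Y} {l : Fin K → Fin K} {R : Fin K → ℝ}
    (hR : ∀ i, 0 ≤ R i) {v : Fin K ⊕ Fin K → ℝ}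
    (hv : v ∈ convexHull ℝ (Set.range (infoVec W l)))
    (h1 : ∀ i, R i * Real.log 2 ≤ v (Sum.inl i))
    (h2 : ∀ j, (R j + R (l j)) * Real.log 2 ≤ v (Sum.inr j)) :
    R ∈ rateRegion W l (2 * K + 1) := by
  obtain ⟨ι, _, z, w, hz, hind, hw, hw1, hwv⟩ := eq_pos_convex_span_of_mem_convexHull hv
  -- The points found are affinely independent in a space of dimension `2 * K`. Their weights become
  -- the law of `Q`.
  have hcard : Fintype.card ι ≤ 2 * K + 1 := by
    refine hind.card_le_finrank_succ.trans ?_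
    have := Submodule.finrank_le (vectorSpan ℝ (Set.range z))
    simp only [Module.finrank_fintype_fun_eq_card, Fintype.card_sum, Fintype.card_fin] at this
    omega
  choose p hp using fun k => hz (Set.mem_range_self k)
  let e := (Fintype.equivFin ι).symm
  rw [mem_rateRegion_iff]
  refine ⟨hR, Fintype.card ι, hcard, ⟨fun q => w (e q), fun q => (hw _).le, ?_⟩,
    fun i q => p (e q) i, fun i => ?_, fun j => ?_⟩
  · rw [e.sum_comp]; exact hw1
  · refine (h1 i).trans (le_of_eq ?_)
    rw [e.sum_comp (fun k => w k * rcvInfo W (p k) i {i}), ← hwv]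
    simp [← hp, infoVec]
  · refine (h2 j).trans (le_of_eq ?_)
    rw [e.sum_comp (fun k => w k * rcvInfo W (p k) j {j, l j}), ← hwv]
    simp [← hp, infoVec]

end Closed

end DMIC

/-! ### The more capable order and its behaviour under products. -/

namespace InfoTheory

section MoreCapable

variable {A B C B' C' : Type*} [Fintype A] [Fintype B] [Fintype C] [Fintype B'] [Fintype C']

/-- For a channel `V` with input weights `μ`, the output entropy minus the conditional output
entropy; the mutual information if `μ` is a probability mass function. -/
noncomputable def channelInfo (V : A → B → ℝ) (μ : A → ℝ) : ℝ :=
  ∑ b, Real.negMulLog (∑ a, μ a * V a b) - ∑ a, μ a * ∑ b, Real.negMulLog (V a b)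

/-- The channel `V` is more capable than the channel `U` with the same inputs. -/
def MoreCapable (V : A → B → ℝ) (U : A → C → ℝ) : Prop :=
  ∀ μ : A → ℝ, (∀ a, 0 ≤ μ a) → channelInfo U μ ≤ channelInfo V μ

lemma channelInfo_comp_equiv (e : C ≃ B) (V : A → B → ℝ) (μ : A → ℝ) :
    channelInfo (fun a c => V a (e c)) μ = channelInfo V μ := by
  unfold channelInfo
  rw [e.sum_comp (fun b => Real.negMulLog (∑ a, μ a * V a b))]
  congr 1
  refine Finset.sum_congr rfl fun a _ => ?_
  rw [e.sum_comp (fun b => Real.negMulLog (V a b))]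

/-- This is the chain rule for two outputs that are independent given the input. Observing `b`
multiplies the weights by `V a b`, and no division is needed because `channelInfo` takes
unnormalized weights. -/
lemma channelInfo_prod (V : A → B → ℝ) (V' : A → B' → ℝ) (hV : ∀ a, ∑ b, V a b = 1)
    (hV' : ∀ a, ∑ b, V' a b = 1) (μ : A → ℝ) :
    channelInfo (fun a (b : B × B') => V a b.1 * V' a b.2) μ =
      ∑ b, channelInfo V' (fun a => μ a * V a b) - ∑ a, μ a * ∑ b, Real.negMulLog (V a b) := by
  unfold channelInfo
  rw [Finset.sum_sub_distrib, sub_sub, Fintype.sum_prod_type]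
  congr 1
  · simp only [mul_assoc]
  · rw [Finset.sum_comm, ← Finset.sum_add_distrib]
    refine Finset.sum_congr rfl fun a _ => ?_
    have : ∑ b : B × B', Real.negMulLog (V a b.1 * V' a b.2) =
        ∑ b, Real.negMulLog (V' a b) + ∑ b, Real.negMulLog (V a b) := by
      rw [Fintype.sum_prod_type]
      simp only [Real.negMulLog_mul, Finset.sum_add_distrib, ← Finset.mul_sum, ← Finset.sum_mul, hV,
        hV', one_mul]
      ring
    rw [this, mul_add]
    simp only [mul_assoc, ← Finset.mul_sum, ← Finset.sum_mul, hV, one_mul]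

lemma channelInfo_prod_comm (V : A → B → ℝ) (V' : A → B' → ℝ) (μ : A → ℝ) :
    channelInfo (fun a (b : B × B') => V a b.1 * V' a b.2) μ =
      channelInfo (fun a (b : B' × B) => V' a b.1 * V a b.2) μ := by
  rw [← channelInfo_comp_equiv (Equiv.prodComm B' B)]
  simp [mul_comm]

/-- The factors are exchanged one at a time. Conditioning on the output of the factor that stays
leaves a sum of informations of the exchanged factor under new nonnegative weights, plus a term
common to both sides. -/
lemma MoreCapable.prod {V : A → B → ℝ} {U : A → C → ℝ} {V' : A → B' → ℝ} {U' : A → C' → ℝ}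
    (h : MoreCapable V U) (h' : MoreCapable V' U')
    (hV0 : ∀ a b, 0 ≤ V a b) (hV : ∀ a, ∑ b, V a b = 1) (hU : ∀ a, ∑ b, U a b = 1)
    (hV' : ∀ a, ∑ b, V' a b = 1) (hU0' : ∀ a b, 0 ≤ U' a b) (hU' : ∀ a, ∑ b, U' a b = 1) :
    MoreCapable (fun a (b : B × B') => V a b.1 * V' a b.2)
      (fun a (b : C × C') => U a b.1 * U' a b.2) := by
  intro μ hμ
  calc channelInfo (fun a (b : C × C') => U a b.1 * U' a b.2) μ
      ≤ channelInfo (fun a (b : B × C') => V a b.1 * U' a b.2) μ := by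
        rw [channelInfo_prod_comm U U', channelInfo_prod_comm V U',
          channelInfo_prod U' U hU' hU, channelInfo_prod U' V hU' hV]
        exact sub_le_sub_right (Finset.sum_le_sum fun c _ =>
          h _ fun a => mul_nonneg (hμ a) (hU0' a c)) _
    _ ≤ channelInfo (fun a (b : B × B') => V a b.1 * V' a b.2) μ := by
        rw [channelInfo_prod V U' hV hU', channelInfo_prod V V' hV hV']
        exact sub_le_sub_right (Finset.sum_le_sum fun b _ =>
          h' _ fun a => mul_nonneg (hμ a) (hV0 a b)) _

/-- The more capable order is preserved by memoryless products. -/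
lemma MoreCapable.pi : ∀ {n : ℕ} {V : Fin n → A → B → ℝ} {U : Fin n → A → C → ℝ}
    (_ : ∀ k, MoreCapable (V k) (U k)) (_ : ∀ k a b, 0 ≤ V k a b) (_ : ∀ k a, ∑ b, V k a b = 1)
    (_ : ∀ k a b, 0 ≤ U k a b) (_ : ∀ k a, ∑ b, U k a b = 1),
    MoreCapable (fun a (z : Fin n → B) => ∏ k, V k a (z k))
      (fun a (z : Fin n → C) => ∏ k, U k a (z k)) := by
  intro n
  induction n with
  | zero =>
    intro V U _ _ _ _ _ μ _
    simp [channelInfo]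
  | succ n ih =>
    intro V U h hV0 hV hU0 hU
    have key := (h 0).prod (ih (fun k => h k.succ) (fun k => hV0 k.succ) (fun k => hV k.succ)
      (fun k => hU0 k.succ) (fun k => hU k.succ)) (hV0 0) (hV 0) (hU 0)
      (fun a => (sum_prodMass_eq_one (u := fun k : Fin n => V k.succ a) (fun k => hV k.succ a)))
      (fun a b => Finset.prod_nonneg fun k _ => hU0 k.succ a _)
      (fun a => (sum_prodMass_eq_one (u := fun k : Fin n => U k.succ a) (fun k => hU k.succ a)))
    intro μ hμ
    have := key μ hμ
    rw [← channelInfo_comp_equiv (Fin.consEquiv (fun _ : Fin (n + 1) => B)) ,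
      ← channelInfo_comp_equiv (Fin.consEquiv (fun _ : Fin (n + 1) => C))]
    simpa [Fin.consEquiv, Fin.prod_univ_succ] using this

/-- The extra term is the same for every stochastic `V`, so a comparison of two channels may be
normalized to probability weights. -/
lemma channelInfo_const_mul (V : A → B → ℝ) (hV : ∀ a, ∑ b, V a b = 1) (μ : A → ℝ) (c : ℝ) :
    channelInfo V (fun a => c * μ a) = c * channelInfo V μ + Real.negMulLog c * ∑ a, μ a := by
  unfold channelInfo
  simp only [mul_assoc, ← Finset.mul_sum, Real.negMulLog_mul, Finset.sum_add_distrib]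
  have : ∑ b, (∑ a, μ a * V a b) = ∑ a, μ a := by
    rw [Finset.sum_comm]
    simp [← Finset.mul_sum, hV]
  rw [← Finset.sum_mul, this]
  ring

end MoreCapable

/-! ### From blocks to single letters. -/

section SingleLetter

variable {ι : Type*} [Fintype ι] [DecidableEq ι] {Z : ι → Type*} [∀ i, Fintype (Z i)]
  {B C : Type*} [Fintype B] [Fintype C]

/-- Freezing the inputs outside `S` at `x` leaves an ordinary channel. This makes the more capable
order applicable to conditional informations. -/
lemma outEntropy_sub_empty {u : ∀ i, Z i → ℝ} (hu : ∀ i, ∑ z, u i z = 1)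
    (U : (∀ i, Z i) → B → ℝ) (S : Finset ι) :
    outEntropy u U S - outEntropy u U ∅ =
      ∑ x, prodMass u x * channelInfo (fun y => U (S.piecewise y x)) (prodMass u) := by
  have h := sum_prodMass_partialAvg hu S (fun x => ∑ b, Real.negMulLog (U x b))
  simp only [channelInfo, mul_sub, Finset.sum_sub_distrib]
  congr 1
  simp only [outEntropy, partialAvg_empty hu]
  rw [← h]
  rfl

lemma natEntropy_eq_sum {Ω α : Type*} [Fintype Ω] [Fintype α] (P : Ω → ℝ) (f : Ω → α) :
    natEntropy P f = ∑ a, Real.negMulLog (law P f a) := by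
  unfold natEntropy
  rw [← sum_law_mul P f (fun a => Real.log (law P f a)), ← Finset.sum_neg_distrib]
  simp [Real.negMulLog]

lemma law_eval_prodMass {v : ∀ i, Z i → ℝ} (hv : ∀ i, ∑ z, v i z = 1) (k : ι) (b : Z k) :
    law (prodMass v) (fun z => z k) b = v k b := by
  classical
  by_cases hne : Nonempty (∀ i, Z i)
  · obtain ⟨x₀⟩ := hne
    have h := law_prodMass_restrict hv {k} (Function.update x₀ k b)
    have h2 := law_comp_congr (P := prodMass v) (f := fun z : ∀ i, Z i => z k)
      (g := ({k} : Finset ι).restrict) (fun z z' => by simp [funext_iff])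
      (Function.update x₀ k b)
    rw [h] at h2
    simpa using h2
  · exfalso
    have := sum_prodMass_eq_one hv
    rw [not_nonempty_iff] at hne
    simp at this

/-- The entropy of a vector is at most the sum of the entropies of its components. -/
lemma natEntropy_le_sum {P : (∀ i, Z i) → ℝ} (hP : ∀ z, 0 ≤ P z) (hP1 : ∑ z, P z = 1) :
    natEntropy P (fun z => z) ≤ ∑ k, natEntropy P (fun z => z k) := by
  have h := natEntropy_le_crossEntropy hP (fun z => z)
    (prodMass fun k => law P (fun z => z k))
    (fun z => prodMass_nonneg (fun k b => law_nonneg hP _ _) z)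
    (by rw [sum_prodMass]; simp [sum_law, hP1])
    (fun z hz => Finset.prod_ne_zero_iff.2 fun k _ => (law_self_pos hP (fun z => z k) hz).ne')
  refine h.trans (le_of_eq ?_)
  unfold natEntropy
  rw [Finset.sum_neg_distrib, Finset.sum_comm]
  congr 1
  refine Finset.sum_congr rfl fun z _ => ?_
  by_cases hz : P z = 0
  · simp [hz]
  rw [prodMass, Real.log_prod fun k _ => (law_self_pos hP (fun z => z k) hz).ne', Finset.mul_sum]

lemma sum_negMulLog_prodMass {v : ∀ i, Z i → ℝ} (hv : ∀ i, ∑ z, v i z = 1) :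
    ∑ z, Real.negMulLog (prodMass v z) = ∑ k, ∑ b, Real.negMulLog (v k b) := by
  have h : ∀ k, ∑ b, Real.negMulLog (v k b) = -∑ z, prodMass v z * Real.log (v k (z k)) := by
    intro k
    rw [← sum_law_mul (prodMass v) (fun z => z k) (fun b => Real.log (v k b)),
      ← Finset.sum_neg_distrib]
    simp [law_eval_prodMass hv, Real.negMulLog]
  simp only [h]
  rw [Finset.sum_neg_distrib, Finset.sum_comm, ← Finset.sum_neg_distrib]
  refine Finset.sum_congr rfl fun z _ => ?_
  by_cases hz : prodMass v z = 0
  · simp [hz]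
  rw [Real.negMulLog, ← Finset.mul_sum]
  nth_rewrite 2 [prodMass]
  rw [Real.log_prod fun k _ => ne_zero_of_prodMass_ne_zero hz k, neg_mul]

lemma outEntropy_pi_empty {n : ℕ} {u : ∀ i, Z i → ℝ} (hu : ∀ i, ∑ z, u i z = 1)
    {V : Fin n → (∀ i, Z i) → B → ℝ} (hV : ∀ k x, ∑ b, V k x b = 1) :
    outEntropy u (fun x (z : Fin n → B) => ∏ k, V k x (z k)) ∅ = ∑ k, outEntropy u (V k) ∅ := by
  simp only [outEntropy, partialAvg_empty hu]
  rw [Finset.sum_comm]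
  refine Finset.sum_congr rfl fun x _ => ?_
  rw [← Finset.mul_sum]
  congr 1
  exact sum_negMulLog_prodMass (v := fun k => V k x) (fun k => hV k x)

/-- For each `x`, subadditivity of entropy is applied to `q`, the law of the block given the inputs
outside `S`, whose marginals are the single-letter averages. All letters share the same inputs, so
`q` need not be a product and only an inequality holds. -/
lemma outEntropy_pi_le {n : ℕ} {u : ∀ i, Z i → ℝ} (hu0 : ∀ i z, 0 ≤ u i z)
    (hu : ∀ i, ∑ z, u i z = 1) {V : Fin n → (∀ i, Z i) → B → ℝ} (hV0 : ∀ k x b, 0 ≤ V k x b)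
    (hV : ∀ k x, ∑ b, V k x b = 1) (S : Finset ι) :
    outEntropy u (fun x (z : Fin n → B) => ∏ k, V k x (z k)) S ≤ ∑ k, outEntropy u (V k) S := by
  simp only [outEntropy]
  rw [Finset.sum_comm]
  refine Finset.sum_le_sum fun x _ => ?_
  rw [← Finset.mul_sum]
  refine mul_le_mul_of_nonneg_left ?_ (prodMass_nonneg hu0 x)
  set q : (Fin n → B) → ℝ := fun z => partialAvg u S (fun x => ∏ k, V k x (z k)) x with hq
  have hq0 : ∀ z, 0 ≤ q z := fun z =>
    partialAvg_nonneg hu0 S (fun x => Finset.prod_nonneg fun k _ => hV0 k x _) x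
  have hq1 : ∑ z, q z = 1 := by
    simp only [hq, partialAvg]
    rw [Finset.sum_comm]
    simp only [← Finset.mul_sum]
    rw [← sum_prodMass_eq_one hu]
    refine Finset.sum_congr rfl fun y _ => ?_
    have := sum_prodMass_eq_one (u := fun k => V k (S.piecewise y x)) (fun k => hV k _)
    simp only [prodMass] at this
    rw [this, mul_one]
  have hmarg : ∀ k b, law q (fun z => z k) b = partialAvg u S (V k · b) x := by
    classical
    intro k b
    have : ∀ y, law (prodMass fun k => V k (S.piecewise y x)) (fun z => z k) b =
        V k (S.piecewise y x) b := fun y => law_eval_prodMass (fun k => hV k _) k b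
    simp only [partialAvg, ← this]
    simp only [law, hq, partialAvg, Finset.mul_sum]
    rw [Finset.sum_comm]
    refine Finset.sum_congr rfl fun z _ => ?_
    by_cases hz : z k = b
    · simp [hz, prodMass]
    · simp [hz]
  have := natEntropy_le_sum hq0 hq1
  simpa only [natEntropy_eq_sum, law_id, hmarg] using this

end SingleLetter

end InfoTheory

/-! ### Strong interference in terms of the more capable order. -/

namespace DMIC

open InfoTheory

variable {K : ℕ} {X Y : Fin K → Type*} [∀ i, Fintype (X i)] [∀ i, Fintype (Y i)]

lemma rcvInfo_nonneg (W : Channel K X Y) (p : ∀ i, stdSimplex ℝ (X i)) (j : Fin K)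
    (S : Finset (Fin K)) : 0 ≤ rcvInfo W p j S := by
  have h1 := condMutualInfo_joint W p j Sᶜ (fun x => x) (fun x x' h _ => h)
  have h2 := natEntropy_submodular (P := joint W p)
    (prodJoint_nonneg (fun i => (p i).2.1) (fun x => (W x).2.1))
    (fun ω => ω.1) (fun ω => ω.2 j) (fun ω => Sᶜ.restrict ω.1)
  rw [compl_compl] at h1
  simp only [condMutualInfo, condEntropy, entropy_eq, ← sub_div] at h1
  rw [div_left_inj' log_two_pos.ne'] at h1
  linarith

/-- A strong interferer has the more capable channel, whatever the other inputs. -/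
lemma IsStrong.moreCapable {W : Channel K X Y} {m j : Fin K} (h : IsStrong W m j)
    {A : Type*} [Fintype A] (x : A → ∀ i, X i)
    (hx : ∀ a a' i, i ≠ m → x a i = x a' i) :
    MoreCapable (fun a => outLaw W j (x a)) (fun a => outLaw W m (x a)) := by
  classical
  intro μ hμ
  set c := ∑ a, μ a with hc
  by_cases hc0 : c = 0
  · have : μ = fun _ => 0 := by
      funext a
      exact (Finset.sum_eq_zero_iff_of_nonneg fun a _ => hμ a).1 (hc ▸ hc0) a (Finset.mem_univ a)
    simp [this, channelInfo]
  have hcpos : 0 < c := lt_of_le_of_ne (Finset.sum_nonneg fun a _ => hμ a) (Ne.symm hc0)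
  set ν : A → ℝ := fun a => c⁻¹ * μ a with hν
  have hν0 : ∀ a, 0 ≤ ν a := fun a => mul_nonneg (inv_nonneg.2 hcpos.le) (hμ a)
  have hν1 : ∑ a, ν a = 1 := by
    simp only [hν]; rw [← Finset.mul_sum, ← hc, inv_mul_cancel₀ hc0]
  have hA : Nonempty A := by
    by_contra hA
    rw [not_nonempty_iff] at hA
    simp at hν1
  obtain ⟨a₀⟩ := hA
  -- These are the marginals of `x` under `ν`. All coordinates but `m` are constant, so the joint
  -- law is the product of its marginals (`hp`), and a hypothesis about product inputs covers
  -- arbitrary weights on `A`.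
  let p : ∀ i, stdSimplex ℝ (X i) := fun i =>
    ⟨law ν (fun a => x a i), law_nonneg hν0 _, by rw [sum_law, hν1]⟩
  have hp : ∀ y, prodMass (fun i => (p i).1) y = law ν x y := by
    intro y
    by_cases hy : ∀ i, i ≠ m → y i = x a₀ i
    · rw [prodMass, Finset.prod_eq_single m]
      · simp only [p, law]
        refine Finset.sum_congr rfl fun a _ => ?_
        have : x a m = y m ↔ x a = y := by
          refine ⟨fun e => funext fun i => ?_, fun e => by rw [e]⟩
          by_cases hi : i = m
          · subst hi; exact e
          · rw [hy i hi, hx a a₀ i hi]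
        by_cases e : x a m = y m
        · rw [if_pos e, if_pos (this.1 e)]
        · rw [if_neg e, if_neg (mt this.2 e)]
      · intro i _ hi
        simp only [p, law]
        rw [← hν1]
        exact Finset.sum_congr rfl fun a _ => if_pos (by rw [hy i hi, hx a a₀ i hi])
      · simp
    · push Not at hy
      obtain ⟨i, hi, hi'⟩ := hy
      rw [prodMass, Finset.prod_eq_zero (Finset.mem_univ i)]
      · rw [law]
        refine (Finset.sum_eq_zero fun a _ => if_neg fun e => hi' ?_).symm
        rw [← e, hx a a₀ i hi]
      · simp only [p, law]
        exact Finset.sum_eq_zero fun a _ => if_neg fun e => hi' (by rw [← e, hx a a₀ i hi])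
  have hsum : ∀ F : (∀ i, X i) → ℝ, ∑ y, prodMass (fun i => (p i).1) y * F y =
      ∑ a, ν a * F (x a) := by
    intro F
    simp only [hp]
    exact sum_law_mul ν x F
  have hinfo : ∀ r : Fin K, rcvInfo W p r {m} = channelInfo (fun a => outLaw W r (x a)) ν := by
    intro r
    unfold rcvInfo rcvEntropy
    rw [outEntropy_sub_empty (fun i => (p i).2.2), hsum]
    have : ∀ a, channelInfo (fun y => outLaw W r (({m} : Finset (Fin K)).piecewise y (x a)))
        (prodMass fun i => (p i).1) = channelInfo (fun a => outLaw W r (x a)) ν := by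
      intro a
      have hpw : ∀ a', ({m} : Finset (Fin K)).piecewise (x a') (x a) = x a' := by
        intro a'
        funext i
        by_cases hi : i = m
        · subst hi; simp
        · simp [hi, hx a a' i hi]
      unfold channelInfo
      congr 1
      · refine Finset.sum_congr rfl fun b _ => ?_
        rw [hsum fun y => outLaw W r (({m} : Finset (Fin K)).piecewise y (x a)) b]
        simp only [hpw]
      · rw [hsum fun y => ∑ b, Real.negMulLog
          (outLaw W r (({m} : Finset (Fin K)).piecewise y (x a)) b)]
        simp only [hpw]
    simp only [this]
    rw [← Finset.sum_mul, hν1, one_mul]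
  have key := h.rcvInfo_le p
  rw [hinfo, hinfo] at key
  have hμν : μ = fun a => c * ν a := by
    funext a
    simp only [hν]
    field_simp
  rw [hμν, channelInfo_const_mul _ (fun a => sum_outLaw W m (x a)),
    channelInfo_const_mul _ (fun a => sum_outLaw W j (x a))]
  gcongr

/-! ### The converse for block codes. -/

section Converse

variable {M : Fin K → ℕ} {n : ℕ}

/-- The uniform law of the messages. -/
noncomputable def msgLaw (M : Fin K → ℕ) (i : Fin K) (_ : Fin (M i)) : ℝ := (M i : ℝ)⁻¹

lemma msgLaw_nonneg (i : Fin K) (w : Fin (M i)) : 0 ≤ msgLaw M i w :=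
  inv_nonneg.2 (Nat.cast_nonneg _)

lemma sum_msgLaw (hM : ∀ i, 0 < M i) (i : Fin K) : ∑ w, msgLaw M i w = 1 := by
  have : (M i : ℝ) ≠ 0 := by exact_mod_cast (hM i).ne'
  simp [msgLaw, this]

lemma prodMass_msgLaw (w : ∀ i, Fin (M i)) : prodMass (msgLaw M) w = (∏ i, (M i : ℝ))⁻¹ := by
  simp [prodMass, msgLaw]

/-- The law of the output sequences given the messages. -/
noncomputable def blockLaw (W : Channel K X Y) (c : Code X Y M n) (w : ∀ i, Fin (M i))
    (y : Fin n → ∀ i, Y i) : ℝ := ∏ k, (W (fun i => c.enc i (w i) k)).1 (y k)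

/-- The law of the output sequence at receiver `j` given the messages. -/
noncomputable def blockOutLaw (W : Channel K X Y) (c : Code X Y M n) (j : Fin K)
    (w : ∀ i, Fin (M i)) (z : Fin n → Y j) : ℝ :=
  ∏ k, outLaw W j (fun i => c.enc i (w i) k) (z k)

lemma blockLaw_nonneg (W : Channel K X Y) (c : Code X Y M n) (w : ∀ i, Fin (M i))
    (y : Fin n → ∀ i, Y i) : 0 ≤ blockLaw W c w y :=
  Finset.prod_nonneg fun _ _ => (W _).2.1 _

lemma sum_blockLaw (W : Channel K X Y) (c : Code X Y M n) (w : ∀ i, Fin (M i)) :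
    ∑ y, blockLaw W c w y = 1 :=
  sum_prodMass_eq_one (u := fun k => (W (fun i => c.enc i (w i) k)).1) fun _ => (W _).2.2

lemma law_blockLaw (W : Channel K X Y) (c : Code X Y M n) (j : Fin K) (w : ∀ i, Fin (M i)) :
    law (blockLaw W c w) (fun y k => y k j) = blockOutLaw W c j w := by
  funext z
  exact law_prodMass (fun k => (W (fun i => c.enc i (w i) k)).1) (fun _ y => y j) z

/-- Fano's inequality at receiver `m`, with the messages outside `S` as side information. An error
at `m` is contained in the event that some receiver errs, and the uniform messages contribute `log
M_i` each, all of which cancel except for `m`. -/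
lemma log_le_of_errorProb (W : Channel K X Y) (c : Code X Y M n) (hM : ∀ i, 0 < M i)
    {S : Finset (Fin K)} {m : Fin K} (hm : m ∈ S) :
    Real.log (M m) ≤ outEntropy (msgLaw M) (blockOutLaw W c m) S -
      outEntropy (msgLaw M) (blockOutLaw W c m) (S.erase m) +
        (Real.log 2 + errorProb W c * Real.log (M m)) := by
  classical
  have hu0 := fun i (w : Fin (M i)) => msgLaw_nonneg (M := M) i w
  have hu := sum_msgLaw hM
  set P := prodJoint (msgLaw M) (blockLaw W c) with hP
  have hP0 : ∀ ω, 0 ≤ P ω := prodJoint_nonneg hu0 (blockLaw_nonneg W c)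
  have hP1 : ∑ ω, P ω = 1 := sum_prodJoint hu (sum_blockLaw W c)
  have key : ∀ A : Finset (Fin K),
      natEntropy P (fun ω => (A.restrict ω.1, fun k => ω.2 k m)) =
        ∑ i ∈ A, Real.log (M i) + outEntropy (msgLaw M) (blockOutLaw W c m) Aᶜ := by
    intro A
    have := natEntropy_restrict_output hu0 hu (blockLaw_nonneg W c) (sum_blockLaw W c)
      (fun y k => y k m) A
    rw [natEntropy_restrict hu (sum_blockLaw W c)] at this
    simp only [law_blockLaw] at this
    rw [this]
    congr 1
    refine Finset.sum_congr rfl fun i _ => ?_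
    simp only [msgLaw, Real.log_inv]
    rw [← Finset.sum_mul, sum_prodMass_eq_one hu]
    ring
  have hF := fano hP0 hP1 (fun ω => ω.1 m) (fun ω => (Sᶜ.restrict ω.1, fun k => ω.2 k m))
    (fun b => c.dec m b.2)
  have e1 : natEntropy P (fun ω => (ω.1 m, Sᶜ.restrict ω.1, fun k => ω.2 k m)) =
      natEntropy P (fun ω => ((S.erase m)ᶜ.restrict ω.1, fun k => ω.2 k m)) := by
    refine natEntropy_congr fun ω ω' => ?_
    simp only [Prod.mk.injEq, ← and_assoc]
    refine and_congr_left fun _ => ?_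
    simp only [funext_iff, Finset.restrict, Subtype.forall]
    refine ⟨fun h i hi => ?_, fun h => ⟨h m (by simp), fun i hi => h i ?_⟩⟩
    · by_cases e : i = m
      · subst e; exact h.1
      · exact h.2 i (by simpa [e] using hi)
    · simp only [Finset.mem_compl, Finset.mem_erase] at hi ⊢; tauto
  have e2 : (S.erase m)ᶜ = insert m Sᶜ := by
    ext i
    by_cases e : i = m
    · simp [e]
    · simp [e]
  have herr : law P (fun ω => c.dec m (fun k => ω.2 k m) ≠ ω.1 m) True ≤ errorProb W c := by
    unfold law errorProb
    rw [Fintype.sum_prod_type, Finset.sum_div]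
    refine Finset.sum_le_sum fun w _ => ?_
    rw [Finset.sum_div]
    refine Finset.sum_le_sum fun y _ => ?_
    by_cases h1 : c.dec m (fun k => y k m) = w m
    · simp only [h1, ne_eq, not_true_eq_false]
      rw [if_neg (by simp)]
      refine div_nonneg ?_ (Finset.prod_nonneg fun i _ => Nat.cast_nonneg _)
      split_ifs
      · exact le_rfl
      · exact blockLaw_nonneg W c w y
    · rw [if_pos (by simpa using h1), if_pos (fun h => h1 (congrFun h m))]
      refine le_of_eq ?_
      rw [hP, prodJoint, prodMass_msgLaw, div_eq_mul_inv, mul_comm, blockLaw]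
  rw [e1, key, key, compl_compl, compl_compl, e2, Finset.sum_insert (by simpa using hm),
    Fintype.card_fin] at hF
  have hlog : 0 ≤ Real.log (M m) := Real.log_natCast_nonneg _
  have := mul_le_mul_of_nonneg_right herr hlog
  linarith

/-- The law of the `k`-th letter of the codewords. -/
noncomputable def letterLaw (c : Code X Y M n) (hM : ∀ i, 0 < M i) (k : Fin n) (i : Fin K) :
    stdSimplex ℝ (X i) :=
  ⟨law (msgLaw M i) (fun w => c.enc i w k), law_nonneg (msgLaw_nonneg i) _, by
    rw [sum_law, sum_msgLaw hM]⟩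

lemma outEntropy_letter (W : Channel K X Y) (c : Code X Y M n) (hM : ∀ i, 0 < M i) (j : Fin K)
    (S : Finset (Fin K)) (k : Fin n) :
    outEntropy (msgLaw M) (fun w => outLaw W j (fun i => c.enc i (w i) k)) S =
      rcvEntropy W (letterLaw c hM k) j S :=
  outEntropy_comp (msgLaw M) (fun i w => c.enc i w k) (outLaw W j) S

/-- The first entropy is subadditive over the letters. The subtracted one is exactly additive,
because the channel is memoryless once all messages are known. -/
lemma outEntropy_block_sub_le (W : Channel K X Y) (c : Code X Y M n) (hM : ∀ i, 0 < M i)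
    (j : Fin K) (S : Finset (Fin K)) :
    outEntropy (msgLaw M) (blockOutLaw W c j) S - outEntropy (msgLaw M) (blockOutLaw W c j) ∅ ≤
      ∑ k, rcvInfo W (letterLaw c hM k) j S := by
  have h1 := outEntropy_pi_le (fun i w => msgLaw_nonneg i w) (sum_msgLaw hM)
    (V := fun k w => outLaw W j (fun i => c.enc i (w i) k)) (fun k w b => outLaw_nonneg W j _ b)
    (fun k w => sum_outLaw W j _) S
  have h2 := outEntropy_pi_empty (sum_msgLaw hM)
    (V := fun k w => outLaw W j (fun i => c.enc i (w i) k)) (fun k w => sum_outLaw W j _)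
  simp only [outEntropy_letter W c hM] at h1 h2
  simp only [rcvInfo, Finset.sum_sub_distrib]
  unfold blockOutLaw
  linarith

/-- With all messages but the `m`-th frozen, each letter of the input varies only in the coordinate
`m`. Thus the channels are comparable letter by letter, and the product order handles the dependence
between the letters of a codeword. -/
lemma IsStrong.outEntropy_block_le {W : Channel K X Y} {m j : Fin K} (h : IsStrong W m j)
    (c : Code X Y M n) (hM : ∀ i, 0 < M i) :
    outEntropy (msgLaw M) (blockOutLaw W c m) {m} - outEntropy (msgLaw M) (blockOutLaw W c m) ∅ ≤
      outEntropy (msgLaw M) (blockOutLaw W c j) {m} -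
        outEntropy (msgLaw M) (blockOutLaw W c j) ∅ := by
  rw [outEntropy_sub_empty (sum_msgLaw hM), outEntropy_sub_empty (sum_msgLaw hM)]
  refine Finset.sum_le_sum fun w _ => mul_le_mul_of_nonneg_left ?_
    (prodMass_nonneg (fun i w => msgLaw_nonneg i w) w)
  refine MoreCapable.pi (A := ∀ i, Fin (M i))
    (V := fun k a => outLaw W j (fun i => c.enc i (({m} : Finset (Fin K)).piecewise a w i) k))
    (U := fun k a => outLaw W m (fun i => c.enc i (({m} : Finset (Fin K)).piecewise a w i) k))
    (fun k => h.moreCapable _ ?_) (fun _ _ _ => outLaw_nonneg W _ _ _)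
    (fun _ _ => sum_outLaw W _ _) (fun _ _ _ => outLaw_nonneg W _ _ _)
    (fun _ _ => sum_outLaw W _ _) _ (prodMass_nonneg fun i w => msgLaw_nonneg i w)
  intro a a' i hi
  simp [hi]

/-- The outer bound for a code of block length `n`. -/
lemma exists_mem_convexHull_of_code {W : Channel K X Y} {l : Fin K → Fin K} (hl : ∀ j, l j ≠ j)
    (hstrong : ∀ j, IsStrong W (l j) j) (hn : 0 < n) (c : Code X Y M n) (hM : ∀ i, 0 < M i) :
    ∃ v ∈ convexHull ℝ (Set.range (infoVec W l)),
      (∀ i, (1 - errorProb W c) * Real.log (M i) - Real.log 2 ≤ n * v (Sum.inl i)) ∧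
      (∀ j, (1 - errorProb W c) * (Real.log (M j) + Real.log (M (l j))) - 2 * Real.log 2 ≤
        n * v (Sum.inr j)) ∧ ∀ i, 0 ≤ v i := by
  have hn0 : (n : ℝ) ≠ 0 := by exact_mod_cast hn.ne'
  refine ⟨∑ k : Fin n, (n : ℝ)⁻¹ • infoVec W l (letterLaw c hM k),
    (convex_convexHull ℝ _).sum_mem (fun _ _ => inv_nonneg.2 (Nat.cast_nonneg n))
      (by simp [hn0]) (fun k _ => subset_convexHull ℝ _ (Set.mem_range_self _)), ?_, ?_, ?_⟩
  · intro i
    have h1 := log_le_of_errorProb W c hM (Finset.mem_singleton_self i)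
    have h2 := outEntropy_block_sub_le W c hM i {i}
    rw [Finset.erase_singleton] at h1
    simp only [Finset.sum_apply, Pi.smul_apply, smul_eq_mul, infoVec, Sum.elim_inl,
      ← Finset.mul_sum, mul_inv_cancel_left₀ hn0]
    linarith
  · intro j
    -- Receiver `j` is given all messages but those of `j` and `l j`, and receiver `l j` all but its
    -- own. After `h3` moves the second bound to receiver `j`, the entropies with `{l j}` cancel.
    have h1 := log_le_of_errorProb W c hM (Finset.mem_insert_self j {l j})
    have h2 := log_le_of_errorProb W c hM (Finset.mem_singleton_self (l j))
    have h3 := (hstrong j).outEntropy_block_le c hM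
    have h4 := outEntropy_block_sub_le W c hM j {j, l j}
    rw [Finset.erase_insert (by simpa using (hl j).symm)] at h1
    rw [Finset.erase_singleton] at h2
    simp only [Finset.sum_apply, Pi.smul_apply, smul_eq_mul, infoVec, Sum.elim_inr,
      ← Finset.mul_sum, mul_inv_cancel_left₀ hn0]
    linarith
  · intro i
    simp only [Finset.sum_apply, Pi.smul_apply, smul_eq_mul]
    refine Finset.sum_nonneg fun k _ => mul_nonneg (inv_nonneg.2 (Nat.cast_nonneg n)) ?_
    cases i <;> exact rcvInfo_nonneg _ _ _ _

end Converse

/-- The converse: achievable rates lie in the rate region. -/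
lemma Achievable.mem_rateRegion {W : Channel K X Y} {l : Fin K → Fin K} (hl : ∀ j, l j ≠ j)
    (hstrong : ∀ j, IsStrong W (l j) j) {R : Fin K → ℝ} (h : Achievable W R) :
    R ∈ rateRegion W l (2 * K + 1) := by
  obtain ⟨hR, c, hc⟩ := h
  -- These are the rates that survive the Fano losses. The larger loss, `2 * log 2` in the sum
  -- bound, becomes `2 / n`, and the maximum keeps the rates nonnegative.
  set R' : ℕ → Fin K → ℝ := fun n i => max 0 ((1 - errorProb W (c n)) * R i - 2 * (1 / n)) with hR'
  have hlim : Tendsto R' atTop (𝓝 R) := by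
    rw [tendsto_pi_nhds]
    intro i
    have h1 : Tendsto (fun n : ℕ => (1 - errorProb W (c n)) * R i - 2 * (1 / n)) atTop
        (𝓝 ((1 - 0) * R i - 2 * 0)) :=
      ((tendsto_const_nhds.sub hc).mul_const _).sub
        (tendsto_one_div_atTop_nhds_zero_nat.const_mul 2)
    have h2 := (tendsto_const_nhds (x := (0 : ℝ))).max h1
    rwa [sub_zero, one_mul, mul_zero, sub_zero, max_eq_right (hR i)] at h2
  refine (isClosed_rateRegion W l _).mem_of_tendsto hlim ?_
  filter_upwards [hc.eventually (gt_mem_nhds (zero_lt_one)), eventually_gt_atTop 0] with n he hn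
  have hn' : (0 : ℝ) < n := by exact_mod_cast hn
  have hpos : ∀ i, 0 < ⌈(2 : ℝ) ^ ((n : ℝ) * R i)⌉₊ := fun i => by positivity
  obtain ⟨v, hv, hv1, hv2, hv0⟩ := exists_mem_convexHull_of_code hl hstrong hn (c n) hpos
  have hlog : ∀ i, n * R i * Real.log 2 ≤ Real.log (⌈(2 : ℝ) ^ ((n : ℝ) * R i)⌉₊ : ℕ) := by
    intro i
    rw [← Real.log_rpow (by norm_num)]
    exact Real.log_le_log (by positivity) (Nat.le_ceil _)
  set e := errorProb W (c n)
  have hb : ∀ i, (1 - e) * (n * R i * Real.log 2) ≤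
      (1 - e) * Real.log (⌈(2 : ℝ) ^ ((n : ℝ) * R i)⌉₊ : ℕ) := fun i =>
    mul_le_mul_of_nonneg_left (hlog i) (by linarith)
  have hn1 : 0 < 1 / (n : ℝ) := one_div_pos.2 hn'
  have b1 : ∀ i, ((1 - e) * R i - 2 * (1 / n)) * Real.log 2 ≤ v (Sum.inl i) := by
    intro i
    refine le_of_mul_le_mul_left ?_ hn'
    have : (n : ℝ) * (((1 - e) * R i - 2 * (1 / n)) * Real.log 2) =
        (1 - e) * (n * R i * Real.log 2) - 2 * Real.log 2 := by field_simp
    linarith [hv1 i, hb i, log_two_pos]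
  have b2 : ∀ j, ((1 - e) * R j + (1 - e) * R (l j) - 2 * (1 / n)) * Real.log 2 ≤
      v (Sum.inr j) := by
    intro j
    refine le_of_mul_le_mul_left ?_ hn'
    have : (n : ℝ) * (((1 - e) * R j + (1 - e) * R (l j) - 2 * (1 / n)) * Real.log 2) =
        (1 - e) * (n * R j * Real.log 2) + (1 - e) * (n * R (l j) * Real.log 2) -
          2 * Real.log 2 := by field_simp
    linarith [hv2 j, hb j, hb (l j)]
  have b3 : ∀ i, 0 ≤ (1 - e) * R i := fun i => mul_nonneg (by linarith) (hR i)
  refine mem_rateRegion_of_mem_convexHull (fun i => le_max_left _ _) hv (fun i => ?_) (fun j => ?_)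
  · simp only [hR']
    rw [max_mul_of_nonneg _ _ log_two_pos.le, zero_mul]
    exact max_le (hv0 _) (b1 i)
  · have h0 : 0 ≤ v (Sum.inr j) / Real.log 2 := div_nonneg (hv0 _) log_two_pos.le
    have hb2 := (le_div_iff₀ log_two_pos).2 (b2 j)
    rw [← le_div_iff₀ log_two_pos]
    simp only [hR']
    have := b3 j
    have := b3 (l j)
    -- `b2` absorbs only one loss `2 / n`. If one rate is truncated at zero, the other still carries
    -- that loss; if both are, nonnegativity of `v` suffices.
    rcases max_cases 0 ((1 - e) * R j - 2 * (1 / (n : ℝ))) with h | h <;>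
      rcases max_cases 0 ((1 - e) * R (l j) - 2 * (1 / (n : ℝ))) with h' | h' <;>
      rw [h.1, h'.1] <;> linarith

end DMIC

/-! ### Chernoff's bound and independent random codewords. -/

namespace InfoTheory

/-- Chernoff: a variable with positive mean has a Laplace transform below `1` somewhere. -/
lemma exists_sum_mul_exp_neg_lt_one {Ω : Type*} [Fintype Ω] {P : Ω → ℝ} (hP : ∀ ω, 0 ≤ P ω)
    (hP1 : ∑ ω, P ω = 1) (φ : Ω → ℝ) (hφ : 0 < ∑ ω, P ω * φ ω) :
    ∃ r : ℝ, 0 < r ∧ ∑ ω, P ω * Real.exp (-(r * φ ω)) < 1 := by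
  set m := ∑ ω, P ω * φ ω with hm
  set b : ℝ := 1 + ∑ ω, |φ ω| with hb
  have hb1 : 1 ≤ b := le_add_of_nonneg_right (Finset.sum_nonneg fun ω _ => abs_nonneg _)
  have hφb : ∀ ω, |φ ω| ≤ b := fun ω =>
    (Finset.single_le_sum (f := fun ω => |φ ω|) (fun ω _ => abs_nonneg _)
      (Finset.mem_univ ω)).trans (by simp [hb])
  have hmb : m ≤ b := by
    calc m ≤ ∑ ω, P ω * b := Finset.sum_le_sum fun ω _ =>
          mul_le_mul_of_nonneg_left ((le_abs_self _).trans (hφb ω)) (hP ω)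
      _ = b := by rw [← Finset.sum_mul, hP1, one_mul]
  have hb0 : 0 < b := by linarith
  -- This minimizes `1 - r * m + (r * b) ^ 2`, the bound obtained from `exp x ≤ 1 + x + x ^ 2` for
  -- `|x| ≤ 1`.
  set r := m / (2 * b ^ 2) with hr
  have hr0 : 0 < r := by positivity
  have hrb : r * b ≤ 1 := by
    rw [hr, div_mul_eq_mul_div, div_le_one (by positivity)]
    nlinarith
  refine ⟨r, hr0, ?_⟩
  have hpt : ∀ ω, P ω * Real.exp (-(r * φ ω)) ≤ P ω - r * (P ω * φ ω) + P ω * (r * b) ^ 2 := by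
    intro ω
    have h1 : |(-(r * φ ω))| ≤ r * b := by
      rw [abs_neg, abs_mul, abs_of_pos hr0]
      exact mul_le_mul_of_nonneg_left (hφb ω) hr0.le
    have h2 := (abs_le.1 (Real.abs_exp_sub_one_sub_id_le (h1.trans hrb))).2
    have h3 : (-(r * φ ω)) ^ 2 ≤ (r * b) ^ 2 := by
      rw [← sq_abs]
      exact pow_le_pow_left₀ (abs_nonneg _) h1 2
    have h4 : Real.exp (-(r * φ ω)) ≤ 1 - r * φ ω + (r * b) ^ 2 := by linarith
    have := mul_le_mul_of_nonneg_left h4 (hP ω)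
    linarith
  have hsum := Finset.sum_le_sum fun ω (_ : ω ∈ Finset.univ) => hpt ω
  rw [Finset.sum_add_distrib, Finset.sum_sub_distrib, ← Finset.mul_sum, ← Finset.sum_mul, hP1,
    ← hm, one_mul] at hsum
  have e : r * m = 2 * (r * b) ^ 2 := by
    rw [hr]; field_simp
  have : 0 < (r * b) ^ 2 := by positivity
  linarith

lemma sum_sum_prod_eq_pow {A O : Type*} [Fintype A] [Fintype O] {n : ℕ} (f : A → O → ℝ) :
    ∑ c : Fin n → A, ∑ y : Fin n → O, ∏ k, f (c k) (y k) = (∑ a, ∑ o, f a o) ^ n := by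
  classical
  rw [Fintype.sum_pow]
  refine Finset.sum_congr rfl fun c _ => ?_
  rw [Finset.prod_univ_sum, Fintype.piFinset_univ]

section RandomWords

variable {ι : Type*} [Fintype ι] [DecidableEq ι] {X : ι → Type*} [∀ i, Fintype (X i)]
  {M : ι → ℕ}

/-- Letters of codewords that are drawn independently: the letters of one codeword per user. -/
lemma sum_prodMass_word {u : ∀ i, X i → ℝ} (hu : ∀ i, ∑ z, u i z = 1) (w : ∀ i, Fin (M i))
    (F : (∀ i, X i) → ℝ) :
    ∑ x : ∀ im : Σ i, Fin (M i), X im.1, prodMass (fun im : Σ i, Fin (M i) => u im.1) x * F (fun i => x ⟨i, w i⟩) =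
      ∑ a, prodMass u a * F a := by
  classical
  rw [← sum_law_mul (prodMass fun im : Σ i, Fin (M i) => u im.1) (fun x i => x ⟨i, w i⟩) F]
  refine Finset.sum_congr rfl fun a _ => ?_
  congr 1
  set e : ι → Σ i, Fin (M i) := fun i => ⟨i, w i⟩ with he
  have hinj : Function.Injective e := fun i i' h => congrArg Sigma.fst h
  have h1 := law_comp_congr (P := prodMass fun im : Σ i, Fin (M i) => u im.1)
    (f := fun x i => x ⟨i, w i⟩) (g := (Finset.univ.image e).restrict) (by
      intro x y
      simp only [funext_iff, Finset.restrict, Subtype.forall]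
      refine ⟨fun h im him => ?_, fun h i => h (e i) (Finset.mem_image_of_mem _ (Finset.mem_univ i))⟩
      obtain ⟨i, -, rfl⟩ := Finset.mem_image.1 him
      exact h i) (fun im => a im.1)
  rw [law_prodMass_restrict (fun im => hu im.1), Finset.prod_image hinj.injOn] at h1
  exact h1

/-- Letters of codewords that are drawn independently: two codewords per user, which differ for
the users in `S`. -/
lemma sum_prodMass_word_word {u : ∀ i, X i → ℝ} (hu : ∀ i, ∑ z, u i z = 1)
    {w w' : ∀ i, Fin (M i)} {S : Finset ι} (hS : ∀ i, i ∈ S ↔ w' i ≠ w i)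
    (F : (∀ i, X i) → (∀ i, X i) → ℝ) :
    ∑ x : ∀ im : Σ i, Fin (M i), X im.1, prodMass (fun im : Σ i, Fin (M i) => u im.1) x *
        F (fun i => x ⟨i, w i⟩) (fun i => x ⟨i, w' i⟩) =
      ∑ a, prodMass u a * ∑ b, prodMass u b * F a (S.piecewise b a) := by
  -- `T` holds the cells read by `w'` but not by `w`. Resampling them makes the new letters
  -- independent of those of `w`.
  set T : Finset (Σ i, Fin (M i)) := S.image fun i => ⟨i, w' i⟩ with hT
  have hmem : ∀ i m, (⟨i, m⟩ : Σ i, Fin (M i)) ∈ T ↔ i ∈ S ∧ m = w' i := by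
    intro i m
    simp only [hT, Finset.mem_image]
    constructor
    · rintro ⟨i', hi', h⟩
      obtain rfl := congrArg Sigma.fst h
      exact ⟨hi', (eq_of_heq (Sigma.mk.inj h).2).symm⟩
    · rintro ⟨h, rfl⟩
      exact ⟨i, h, rfl⟩
  rw [← sum_prodMass_partialAvg (u := fun im : Σ i, Fin (M i) => u im.1) (fun im => hu im.1) T]
  have h1 : ∀ x : ∀ im : Σ i, Fin (M i), X im.1,
      partialAvg (fun im : Σ i, Fin (M i) => u im.1) T
        (fun x => F (fun i => x ⟨i, w i⟩) (fun i => x ⟨i, w' i⟩)) x =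
      ∑ b, prodMass u b * F (fun i => x ⟨i, w i⟩) (S.piecewise b (fun i => x ⟨i, w i⟩)) := by
    intro x
    rw [← sum_prodMass_word hu w'
      (fun b => F (fun i => x ⟨i, w i⟩) (S.piecewise b (fun i => x ⟨i, w i⟩))), partialAvg]
    refine Finset.sum_congr rfl fun y _ => ?_
    congr 2
    · funext i
      rw [Finset.piecewise_eq_of_notMem]
      rw [hmem, hS]
      rintro ⟨h, h'⟩
      exact h h'.symm
    · funext i
      by_cases hi : i ∈ S
      · rw [Finset.piecewise_eq_of_mem _ _ _ hi, Finset.piecewise_eq_of_mem]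
        exact (hmem _ _).2 ⟨hi, rfl⟩
      · rw [Finset.piecewise_eq_of_notMem _ _ _ hi, Finset.piecewise_eq_of_notMem]
        · have : w' i = w i := by
            by_contra h
            exact hi ((hS i).2 h)
          exact congrArg (β := X i) (fun m => x ⟨i, m⟩) this
        · exact fun h => hi ((hmem _ _).1 h).1
  simp only [h1]
  exact sum_prodMass_word hu w (fun a => ∑ b, prodMass u b * F a (S.piecewise b a))

end RandomWords

end InfoTheory

/-! ### Random codebooks and the error exponents of the threshold tests. -/

namespace DMIC

open InfoTheory

variable {K : ℕ} {X Y : Fin K → Type*} [∀ i, Fintype (X i)] [∀ i, Fintype (Y i)] {s : ℕ}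

/-- The law of the output at `j` given the time-sharing variable and the inputs outside `S`. -/
noncomputable def condOut (W : Channel K X Y) (p : ∀ i, Fin s → stdSimplex ℝ (X i)) (j : Fin K)
    (S : Finset (Fin K)) (q : Fin s) (x : ∀ i, X i) (b : Y j) : ℝ :=
  partialAvg (fun i => (p i q).1) S (outLaw W j · b) x

lemma condOut_nonneg (W : Channel K X Y) (p : ∀ i, Fin s → stdSimplex ℝ (X i)) (j : Fin K)
    (S : Finset (Fin K)) (q : Fin s) (x : ∀ i, X i) (b : Y j) : 0 ≤ condOut W p j S q x b :=
  partialAvg_nonneg (fun i => (p i q).2.1) S (fun x => outLaw_nonneg W j x b) x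

/-- The mutual information in nats between the inputs in `S` and the output at `j`, given the
other inputs and the time-sharing variable. -/
noncomputable def tsInfo (W : Channel K X Y) (pQ : stdSimplex ℝ (Fin s))
    (p : ∀ i, Fin s → stdSimplex ℝ (X i)) (j : Fin K) (S : Finset (Fin K)) : ℝ :=
  ∑ q, pQ.1 q * rcvInfo W (fun i => p i q) j S

/-- The Laplace transform of the excess of the information density over the threshold `t`. -/
noncomputable def missFactor (W : Channel K X Y) (pQ : stdSimplex ℝ (Fin s))
    (p : ∀ i, Fin s → stdSimplex ℝ (X i)) (j : Fin K) (S : Finset (Fin K)) (t r : ℝ) : ℝ :=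
  ∑ q, pQ.1 q * ∑ a, prodMass (fun i => (p i q).1) a *
    ∑ b, outLaw W j a b * (Real.exp t * condOut W p j S q a b / outLaw W j a b) ^ r

lemma missFactor_nonneg (W : Channel K X Y) (pQ : stdSimplex ℝ (Fin s))
    (p : ∀ i, Fin s → stdSimplex ℝ (X i)) (j : Fin K) (S : Finset (Fin K)) (t r : ℝ) :
    0 ≤ missFactor W pQ p j S t r :=
  Finset.sum_nonneg fun q _ => mul_nonneg (pQ.2.1 q) <| Finset.sum_nonneg fun a _ =>
    mul_nonneg (prodMass_nonneg (fun i => (p i q).2.1) a) <| Finset.sum_nonneg fun b _ =>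
      mul_nonneg (outLaw_nonneg W j a b) <| Real.rpow_nonneg (div_nonneg
        (mul_nonneg (Real.exp_pos t).le (condOut_nonneg W p j S q a b)) (outLaw_nonneg W j a b)) r

/-- The information density has mean `tsInfo`, so its excess `φ` over `t` has positive mean and
Chernoff's bound applies. -/
lemma exists_missFactor_lt_one (W : Channel K X Y) (pQ : stdSimplex ℝ (Fin s))
    (p : ∀ i, Fin s → stdSimplex ℝ (X i)) (j : Fin K) (S : Finset (Fin K)) {t : ℝ}
    (ht : t < tsInfo W pQ p j S) : ∃ r, 0 < r ∧ missFactor W pQ p j S t r < 1 := by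
  set P : Fin s × (∀ i, X i) × Y j → ℝ := fun ω =>
    pQ.1 ω.1 * (prodMass (fun i => (p i ω.1).1) ω.2.1 * outLaw W j ω.2.1 ω.2.2) with hP
  set φ : Fin s × (∀ i, X i) × Y j → ℝ := fun ω =>
    Real.log (outLaw W j ω.2.1 ω.2.2) - Real.log (condOut W p j S ω.1 ω.2.1 ω.2.2) - t with hφ
  have hsum : ∀ F : Fin s × (∀ i, X i) × Y j → ℝ, ∑ ω, P ω * F ω = ∑ q, pQ.1 q *
      ∑ a, prodMass (fun i => (p i q).1) a * ∑ b, outLaw W j a b * F (q, a, b) := by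
    intro F
    simp only [Fintype.sum_prod_type, Finset.mul_sum, hP, mul_assoc]
  have hP0 : ∀ ω, 0 ≤ P ω := fun ω => mul_nonneg (pQ.2.1 _) (mul_nonneg
    (prodMass_nonneg (fun i => (p i _).2.1) _) (outLaw_nonneg W j _ _))
  have hp1 : ∀ q, ∑ a, prodMass (fun i => (p i q).1) a = 1 := fun q =>
    sum_prodMass_eq_one fun i => (p i q).2.2
  have hP1 : ∑ ω, P ω = 1 := by
    have := hsum fun _ => 1
    simpa [sum_outLaw, hp1, pQ.2.2] using this
  have hmean : ∑ ω, P ω * φ ω = tsInfo W pQ p j S - t := by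
    rw [hsum]
    have h1 : ∀ q, ∑ a, prodMass (fun i => (p i q).1) a * ∑ b, outLaw W j a b * φ (q, a, b) =
        rcvInfo W (fun i => p i q) j S - t := by
      intro q
      unfold rcvInfo rcvEntropy
      rw [outEntropy_eq (fun i => (p i q).2.2), outEntropy_eq (fun i => (p i q).2.2)]
      simp only [partialAvg_empty (fun i => (p i q).2.2), hφ, mul_sub, Finset.sum_sub_distrib,
        ← Finset.sum_mul, sum_outLaw, one_mul, hp1, condOut]
      ring
    simp only [h1, mul_sub, Finset.sum_sub_distrib, ← Finset.sum_mul, pQ.2.2, one_mul, tsInfo]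
  obtain ⟨r, hr, h⟩ := exists_sum_mul_exp_neg_lt_one hP0 hP1 φ (by rw [hmean]; linarith)
  refine ⟨r, hr, lt_of_le_of_lt (le_of_eq ?_) h⟩
  have : missFactor W pQ p j S t r = ∑ ω, P ω *
      (Real.exp t * condOut W p j S ω.1 ω.2.1 ω.2.2 / outLaw W j ω.2.1 ω.2.2) ^ r := by
    rw [hsum]; rfl
  rw [this]
  refine Finset.sum_congr rfl fun ω _ => ?_
  by_cases h0 : P ω = 0
  · simp [h0]
  have h1 : outLaw W j ω.2.1 ω.2.2 ≠ 0 := right_ne_zero_of_mul (right_ne_zero_of_mul h0)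
  have h2 : condOut W p j S ω.1 ω.2.1 ω.2.2 ≠ 0 :=
    partialAvg_self_ne_zero (fun i => (p i ω.1).2.1) S (fun x => outLaw_nonneg W j x _)
      (left_ne_zero_of_mul (right_ne_zero_of_mul h0)) h1
  have h1' := lt_of_le_of_ne (outLaw_nonneg W j _ _) h1.symm
  have h2' := lt_of_le_of_ne (condOut_nonneg W p j S _ _ _) h2.symm
  rw [Real.rpow_def_of_pos (by positivity), Real.log_div (by positivity) h1,
    Real.log_mul (Real.exp_pos t).ne' h2, Real.log_exp]
  congr 2
  simp only [hφ]; ring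

section RandomCode

variable {M : Fin K → ℕ} {n : ℕ}

/-- One letter of a random codebook: the time-sharing variable and one letter of each codeword of
each user. -/
abbrev BookLetter (X : Fin K → Type*) (M : Fin K → ℕ) (s : ℕ) :=
  Fin s × (∀ im : Σ i, Fin (M i), X im.1)

/-- The law of one letter of the random codebook. -/
noncomputable def bookMass (pQ : stdSimplex ℝ (Fin s)) (p : ∀ i, Fin s → stdSimplex ℝ (X i))
    (c : BookLetter X M s) : ℝ :=
  pQ.1 c.1 * prodMass (fun im : Σ i, Fin (M i) => (p im.1 c.1).1) c.2

lemma bookMass_nonneg (pQ : stdSimplex ℝ (Fin s)) (p : ∀ i, Fin s → stdSimplex ℝ (X i))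
    (c : BookLetter X M s) : 0 ≤ bookMass pQ p c :=
  mul_nonneg (pQ.2.1 _) (prodMass_nonneg (fun im => (p im.1 c.1).2.1) _)

lemma sum_bookMass (pQ : stdSimplex ℝ (Fin s)) (p : ∀ i, Fin s → stdSimplex ℝ (X i)) :
    ∑ c : BookLetter X M s, bookMass pQ p c = 1 := by
  rw [Fintype.sum_prod_type]
  simp only [bookMass, ← Finset.mul_sum]
  have : ∀ q, ∑ x, prodMass (fun im : Σ i, Fin (M i) => (p im.1 q).1) x = 1 := fun q =>
    sum_prodMass_eq_one fun im => (p im.1 q).2.2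
  simp only [this, mul_one, pQ.2.2]

/-- The letters of the codewords of the messages `w`. -/
def word (w : ∀ i, Fin (M i)) (c : BookLetter X M s) (i : Fin K) : X i := c.2 ⟨i, w i⟩

lemma prodMass_word_ne_zero {pQ : stdSimplex ℝ (Fin s)} {p : ∀ i, Fin s → stdSimplex ℝ (X i)}
    {c : BookLetter X M s} (h : bookMass pQ p c ≠ 0) (w : ∀ i, Fin (M i)) :
    prodMass (fun i => (p i c.1).1) (word w c) ≠ 0 :=
  Finset.prod_ne_zero_iff.2 fun i _ =>
    ne_zero_of_prodMass_ne_zero (right_ne_zero_of_mul h) (⟨i, w i⟩ : Σ i, Fin (M i))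

/-- The threshold test of receiver `j` for the messages `w` and the users in `S`. -/
def Passes (W : Channel K X Y) (p : ∀ i, Fin s → stdSimplex ℝ (X i)) (j : Fin K)
    (S : Finset (Fin K)) (t : ℝ) (c : Fin n → BookLetter X M s) (w : ∀ i, Fin (M i))
    (z : Fin n → Y j) : Prop :=
  ∏ k, Real.exp t * condOut W p j S (c k).1 (word w (c k)) (z k) <
    ∏ k, outLaw W j (word w (c k)) (z k)

lemma outLaw_ne_zero {W : Channel K X Y} {x : ∀ i, X i} {y : ∀ i, Y i} (h : (W x).1 y ≠ 0)
    (j : Fin K) : outLaw W j x (y j) ≠ 0 :=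
  (law_self_pos (W x).2.1 (fun y => y j) h).ne'

/-- The joint law of the random codebook and of the outputs for the messages `w`. -/
noncomputable def trialMass (W : Channel K X Y) (pQ : stdSimplex ℝ (Fin s))
    (p : ∀ i, Fin s → stdSimplex ℝ (X i)) (w : ∀ i, Fin (M i)) (c : Fin n → BookLetter X M s)
    (y : Fin n → ∀ i, Y i) : ℝ :=
  ∏ k, bookMass pQ p (c k) * (W (word w (c k))).1 (y k)

lemma trialMass_nonneg (W : Channel K X Y) (pQ : stdSimplex ℝ (Fin s))
    (p : ∀ i, Fin s → stdSimplex ℝ (X i)) (w : ∀ i, Fin (M i)) (c : Fin n → BookLetter X M s)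
    (y : Fin n → ∀ i, Y i) : 0 ≤ trialMass W pQ p w c y :=
  Finset.prod_nonneg fun _ _ => mul_nonneg (bookMass_nonneg pQ p _) ((W _).2.1 _)

open Classical in
/-- The true messages fail a test with exponentially small probability. -/
lemma sum_trialMass_not_passes_le (W : Channel K X Y) (pQ : stdSimplex ℝ (Fin s))
    (p : ∀ i, Fin s → stdSimplex ℝ (X i)) (w : ∀ i, Fin (M i)) (j : Fin K) (S : Finset (Fin K))
    (t : ℝ) {r : ℝ} (hr : 0 < r) :
    ∑ c : Fin n → BookLetter X M s, ∑ y : Fin n → ∀ i, Y i,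
      (if ¬ Passes W p j S t c w (fun k => y k j) then trialMass W pQ p w c y else 0) ≤
      missFactor W pQ p j S t r ^ n := by
  have e : missFactor W pQ p j S t r = ∑ c : BookLetter X M s, ∑ y : ∀ i, Y i,
      bookMass pQ p c * (W (word w c)).1 y * (Real.exp t *
        condOut W p j S c.1 (word w c) (y j) / outLaw W j (word w c) (y j)) ^ r := by
    rw [Fintype.sum_prod_type]
    unfold missFactor
    refine Finset.sum_congr rfl fun q _ => ?_
    rw [← sum_prodMass_word (fun i => (p i q).2.2) w, Finset.mul_sum]
    refine Finset.sum_congr rfl fun x _ => ?_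
    simp only [bookMass, mul_assoc, ← Finset.mul_sum]
    congr 2
    exact sum_law_mul (W (word w (q, x))).1 (fun y => y j) (fun b =>
      (Real.exp t * condOut W p j S q (word w (q, x)) b / outLaw W j (word w (q, x)) b) ^ r)
  rw [e, ← sum_sum_prod_eq_pow (fun (c : BookLetter X M s) (y : ∀ i, Y i) =>
      bookMass pQ p c * (W (word w c)).1 y * (Real.exp t *
        condOut W p j S c.1 (word w c) (y j) / outLaw W j (word w c) (y j)) ^ r)]
  refine Finset.sum_le_sum fun c _ => Finset.sum_le_sum fun y _ => ?_
  have hnn : ∀ k, 0 ≤ Real.exp t * condOut W p j S (c k).1 (word w (c k)) (y k j) /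
      outLaw W j (word w (c k)) (y k j) := fun k =>
    div_nonneg (mul_nonneg (Real.exp_pos t).le (condOut_nonneg W p j S _ _ _))
      (outLaw_nonneg W j _ _)
  rw [Finset.prod_mul_distrib, Real.finsetProd_rpow _ _ fun _ _ => hnn _]
  change _ ≤ trialMass W pQ p w c y * _
  have h0 := trialMass_nonneg W pQ p w c y
  split_ifs with h
  · exact mul_nonneg h0 (Real.rpow_nonneg (Finset.prod_nonneg fun k _ => hnn k) _)
  · by_cases hz : trialMass W pQ p w c y = 0
    · simp [hz]
    -- Markov's inequality: a failed test means that the product of the ratios is at least one, and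
    -- so is its `r`-th power.
    refine le_mul_of_one_le_right h0 (Real.one_le_rpow ?_ hr.le)
    rw [Finset.prod_div_distrib, one_le_div]
    · exact not_lt.1 h
    · refine Finset.prod_pos fun k _ => lt_of_le_of_ne (outLaw_nonneg W j _ _) (Ne.symm ?_)
      exact outLaw_ne_zero (right_ne_zero_of_mul
        (Finset.prod_ne_zero_iff.1 hz k (Finset.mem_univ k))) j

open Classical in
/-- Wrong messages, which differ from the true ones for the users in `S`, pass the test with
exponentially small probability. -/
lemma sum_trialMass_passes_le (W : Channel K X Y) (pQ : stdSimplex ℝ (Fin s))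
    (p : ∀ i, Fin s → stdSimplex ℝ (X i)) {w w' : ∀ i, Fin (M i)} (j : Fin K)
    {S : Finset (Fin K)} (hS : ∀ i, i ∈ S ↔ w' i ≠ w i) (t : ℝ) :
    ∑ c : Fin n → BookLetter X M s, ∑ y : Fin n → ∀ i, Y i,
      (if Passes W p j S t c w' (fun k => y k j) then trialMass W pQ p w c y else 0) ≤
      Real.exp (-t) ^ n := by
  -- The reference law depends only on the inputs outside `S`, where the codewords of `w` and `w'`
  -- agree.
  have hcond : ∀ (c : BookLetter X M s) b,
      condOut W p j S c.1 (word w' c) b = condOut W p j S c.1 (word w c) b := by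
    intro c b
    have : word w' c = S.piecewise (word w' c) (word w c) := by
      funext i
      by_cases hi : i ∈ S
      · simp [hi]
      · have : w' i = w i := by
          by_contra h
          exact hi ((hS i).2 h)
        rw [Finset.piecewise_eq_of_notMem _ _ _ hi]
        exact congrArg (β := X i) (fun m => c.2 ⟨i, m⟩) this
    rw [this]
    exact partialAvg_piecewise _ _ _ _ _
  have hle : ∑ c : BookLetter X M s, ∑ y : ∀ i, Y i, bookMass pQ p c * (W (word w c)).1 y *
      (outLaw W j (word w' c) (y j) /
        (Real.exp t * condOut W p j S c.1 (word w' c) (y j))) ≤ Real.exp (-t) := by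
    simp only [hcond]
    rw [Fintype.sum_prod_type]
    calc _ = ∑ q, pQ.1 q * ∑ a, prodMass (fun i => (p i q).1) a * ∑ b,
          prodMass (fun i => (p i q).1) b * ∑ y, (W a).1 y * (outLaw W j (S.piecewise b a) (y j) /
            (Real.exp t * condOut W p j S q a (y j))) := by
          refine Finset.sum_congr rfl fun q _ => ?_
          rw [← sum_prodMass_word_word (fun i => (p i q).2.2) hS (fun a b =>
            ∑ y, (W a).1 y * (outLaw W j b (y j) / (Real.exp t * condOut W p j S q a (y j)))),
            Finset.mul_sum]
          refine Finset.sum_congr rfl fun x _ => ?_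
          simp only [bookMass, mul_assoc, ← Finset.mul_sum]
          rfl
      _ = ∑ q, pQ.1 q * ∑ a, prodMass (fun i => (p i q).1) a * ∑ y, (W a).1 y *
            (condOut W p j S q a (y j) / (Real.exp t * condOut W p j S q a (y j))) := by
          refine Finset.sum_congr rfl fun q _ => ?_
          congr 1
          refine Finset.sum_congr rfl fun a _ => ?_
          congr 1
          simp only [Finset.mul_sum]
          rw [Finset.sum_comm]
          refine Finset.sum_congr rfl fun y _ => ?_
          nth_rewrite 2 [condOut]
          rw [partialAvg, Finset.sum_div, Finset.mul_sum]
          refine Finset.sum_congr rfl fun b _ => ?_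
          ring
      _ ≤ ∑ q, pQ.1 q * ∑ a, prodMass (fun i => (p i q).1) a * ∑ y, (W a).1 y *
            Real.exp (-t) := by
          refine Finset.sum_le_sum fun q _ => mul_le_mul_of_nonneg_left ?_ (pQ.2.1 q)
          refine Finset.sum_le_sum fun a _ => mul_le_mul_of_nonneg_left ?_
            (prodMass_nonneg (fun i => (p i q).2.1) a)
          refine Finset.sum_le_sum fun y _ => mul_le_mul_of_nonneg_left ?_ ((W a).2.1 y)
          rw [Real.exp_neg]
          -- Averaging the wrong letters has turned `outLaw` into `condOut`, which cancels. Where it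
          -- vanishes the quotient is zero by convention, hence only an inequality.
          by_cases h : condOut W p j S q a (y j) = 0
          · simp [h, (Real.exp_pos t).le]
          · rw [mul_comm, div_mul_cancel_left₀ h]
      _ = Real.exp (-t) := by
          have h1 : ∀ q, ∑ a, prodMass (fun i => (p i q).1) a = 1 := fun q =>
            sum_prodMass_eq_one fun i => (p i q).2.2
          have h2 : ∀ a, ∑ y, (W a).1 y = 1 := fun a => (W a).2.2
          simp only [← Finset.sum_mul, h1, h2, pQ.2.2, one_mul]
  have hnn : ∀ (c : BookLetter X M s) (y : ∀ i, Y i), 0 ≤ outLaw W j (word w' c) (y j) /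
      (Real.exp t * condOut W p j S c.1 (word w' c) (y j)) := fun c y =>
    div_nonneg (outLaw_nonneg W j _ _)
      (mul_nonneg (Real.exp_pos t).le (condOut_nonneg W p j S _ _ _))
  refine le_trans ?_ (pow_le_pow_left₀ (Finset.sum_nonneg fun c _ => Finset.sum_nonneg fun y _ =>
    mul_nonneg (mul_nonneg (bookMass_nonneg pQ p c) ((W _).2.1 y)) (hnn c y)) hle n)
  rw [← sum_sum_prod_eq_pow (fun (c : BookLetter X M s) (y : ∀ i, Y i) =>
      bookMass pQ p c * (W (word w c)).1 y * (outLaw W j (word w' c) (y j) /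
        (Real.exp t * condOut W p j S c.1 (word w' c) (y j))))]
  refine Finset.sum_le_sum fun c _ => Finset.sum_le_sum fun y _ => ?_
  rw [Finset.prod_mul_distrib]
  change _ ≤ trialMass W pQ p w c y * _
  have h0 := trialMass_nonneg W pQ p w c y
  split_ifs with h
  · by_cases hz : trialMass W pQ p w c y = 0
    · simp [hz]
    refine le_mul_of_one_le_right h0 ?_
    rw [Finset.prod_div_distrib, one_le_div]
    · exact h.le
    · refine Finset.prod_pos fun k _ => mul_pos (Real.exp_pos t)
        (lt_of_le_of_ne (condOut_nonneg W p j S _ _ _) (Ne.symm ?_))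
      have hk := Finset.prod_ne_zero_iff.1 hz k (Finset.mem_univ k)
      rw [hcond]
      exact partialAvg_self_ne_zero (fun i => (p i (c k).1).2.1) S
        (fun x => outLaw_nonneg W j x _) (prodMass_word_ne_zero (left_ne_zero_of_mul hk) w)
        (outLaw_ne_zero (right_ne_zero_of_mul hk) j)
  · exact mul_nonneg h0 (Finset.prod_nonneg fun k _ => hnn _ _)

end RandomCode

end DMIC

/-! ### The random coding bound and achievability. -/

namespace DMIC

open InfoTheory

variable {K : ℕ} {X Y : Fin K → Type*} [∀ i, Fintype (X i)] [∀ i, Fintype (Y i)] {s : ℕ}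
  {M : Fin K → ℕ} {n : ℕ}

open Classical in
/-- The code given by a codebook; each receiver looks for the messages of all users that pass all
the tests. -/
noncomputable def bookCode (W : Channel K X Y) (p : ∀ i, Fin s → stdSimplex ℝ (X i))
    (𝒮 : Finset (Finset (Fin K))) (t : Fin K → Finset (Fin K) → ℝ) (hM : ∀ i, 0 < M i)
    (c : Fin n → BookLetter X M s) : Code X Y M n where
  enc i m k := (c k).2 ⟨i, m⟩
  dec j z := if h : ∃ w, ∀ S ∈ 𝒮, Passes W p j S (t j S) c w z then h.choose j else ⟨0, hM j⟩

/-- The message tuples that differ from `w` exactly for the users in `S`. -/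
def differOn (w : ∀ i, Fin (M i)) (S : Finset (Fin K)) : Finset (∀ i, Fin (M i)) :=
  Fintype.piFinset fun i => if i ∈ S then {w i}ᶜ else {w i}

lemma mem_differOn {w w' : ∀ i, Fin (M i)} {S : Finset (Fin K)} :
    w' ∈ differOn w S ↔ ∀ i, i ∈ S ↔ w' i ≠ w i := by
  rw [differOn, Fintype.mem_piFinset]
  refine forall_congr' fun i => ?_
  by_cases h : i ∈ S <;> simp [h]

lemma card_differOn (w : ∀ i, Fin (M i)) (S : Finset (Fin K)) :
    (differOn w S).card = ∏ i ∈ S, (M i - 1) := by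
  rw [differOn, Fintype.card_piFinset, ← Finset.prod_subset (Finset.subset_univ S)]
  · refine Finset.prod_congr rfl fun i hi => ?_
    simp [hi, Finset.card_compl]
  · intro i _ hi
    simp [hi]

open Classical in
-- If receiver `j` errs, either the true messages fail some test or the chosen tuple is a wrong one
-- that passes all of them. A wrong tuple is charged only to the test for the set where it differs
-- from `w`. That set contains `j` and only users with at least two messages, so it lies in `𝒮`.
lemma error_indicator_le (W : Channel K X Y) (p : ∀ i, Fin s → stdSimplex ℝ (X i))
    {𝒮 : Finset (Finset (Fin K))} (t : Fin K → Finset (Fin K) → ℝ) (hM : ∀ i, 0 < M i)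
    (h𝒮 : ∀ S : Finset (Fin K), S.Nonempty → (∀ i ∈ S, 1 < M i) → S ∈ 𝒮)
    (c : Fin n → BookLetter X M s) (w : ∀ i, Fin (M i)) (y : Fin n → ∀ i, Y i) {T : ℝ}
    (hT : 0 ≤ T) :
    (if (fun j => (bookCode W p 𝒮 t hM c).dec j (fun k => y k j)) ≠ w then T else 0) ≤
      ∑ j, ∑ S ∈ 𝒮, ((if ¬ Passes W p j S (t j S) c w (fun k => y k j) then T else 0) +
        ∑ w' ∈ differOn w S, if Passes W p j S (t j S) c w' (fun k => y k j) then T else 0) := by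
  have hite : ∀ (q : Prop) [Decidable q], 0 ≤ if q then T else 0 := fun q _ => by
    split_ifs <;> simp [hT]
  have hnn : ∀ j S, 0 ≤ (if ¬ Passes W p j S (t j S) c w (fun k => y k j) then T else 0) +
      ∑ w' ∈ differOn w S, if Passes W p j S (t j S) c w' (fun k => y k j) then T else 0 :=
    fun j S => add_nonneg (hite _) (Finset.sum_nonneg fun w' _ => hite _)
  split_ifs with herr
  swap
  · exact Finset.sum_nonneg fun j _ => Finset.sum_nonneg fun S _ => hnn j S
  obtain ⟨j, hj⟩ := Function.ne_iff.1 herr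
  refine le_trans ?_ (Finset.single_le_sum (f := fun j => ∑ S ∈ 𝒮, _)
    (fun j _ => Finset.sum_nonneg fun S _ => hnn j S) (Finset.mem_univ j))
  by_cases hw : ∀ S ∈ 𝒮, Passes W p j S (t j S) c w (fun k => y k j)
  · have hex : ∃ w, ∀ S ∈ 𝒮, Passes W p j S (t j S) c w (fun k => y k j) := ⟨w, hw⟩
    have hdec : (bookCode W p 𝒮 t hM c).dec j (fun k => y k j) = hex.choose j := by
      simp only [bookCode]
      rw [dif_pos hex]
    rw [hdec] at hj
    set w' := hex.choose with hw'
    have hspec : ∀ S ∈ 𝒮, Passes W p j S (t j S) c w' (fun k => y k j) := hex.choose_spec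
    set S : Finset (Fin K) := Finset.univ.filter fun i => w' i ≠ w i with hS
    have hmem : w' ∈ differOn w S := mem_differOn.2 fun i => by simp [hS]
    have hS𝒮 : S ∈ 𝒮 := by
      refine h𝒮 S ⟨j, by simpa [hS] using hj⟩ fun i hi => ?_
      have hi' : w' i ≠ w i := by simpa [hS] using hi
      by_contra hM1
      have h1 := (w' i).2
      have h2 := (w i).2
      exact hi' (Fin.ext (by omega))
    refine le_trans ?_ (Finset.single_le_sum (fun S _ => hnn j S) hS𝒮)
    refine le_trans ?_ (le_add_of_nonneg_left (hite _))
    refine le_trans ?_ (Finset.single_le_sum (fun w' _ => hite _) hmem)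
    rw [if_pos (hspec S hS𝒮)]
  · push Not at hw
    obtain ⟨S, hS, hns⟩ := hw
    refine le_trans ?_ (Finset.single_le_sum (fun S _ => hnn j S) hS)
    rw [if_pos hns]
    exact le_add_of_nonneg_right (Finset.sum_nonneg fun w' _ => hite _)

lemma sum_sum_sum_comm {A B C : Type*} (s : Finset A) (t : Finset B) (v : Finset C)
    (F : A → B → C → ℝ) :
    ∑ a ∈ s, ∑ b ∈ t, ∑ c ∈ v, F a b c = ∑ c ∈ v, ∑ a ∈ s, ∑ b ∈ t, F a b c :=
  (Finset.sum_congr rfl fun _ _ => Finset.sum_comm).trans Finset.sum_comm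

/-- Random coding: some code is as good as the average of the random codebooks. -/
lemma exists_code_errorProb_le (W : Channel K X Y) (pQ : stdSimplex ℝ (Fin s))
    (p : ∀ i, Fin s → stdSimplex ℝ (X i))
    {𝒮 : Finset (Finset (Fin K))} (t r : Fin K → Finset (Fin K) → ℝ) (hr : ∀ j S, 0 < r j S)
    (hM : ∀ i, 0 < M i)
    (h𝒮 : ∀ S : Finset (Fin K), S.Nonempty → (∀ i ∈ S, 1 < M i) → S ∈ 𝒮) :
    ∃ c : Code X Y M n, errorProb W c ≤ ∑ j, ∑ S ∈ 𝒮,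
      (missFactor W pQ p j S (t j S) (r j S) ^ n +
        (∏ i ∈ S, ((M i : ℝ) - 1)) * Real.exp (-t j S) ^ n) := by
  classical
  set b := ∑ j, ∑ S ∈ 𝒮, (missFactor W pQ p j S (t j S) (r j S) ^ n +
        (∏ i ∈ S, ((M i : ℝ) - 1)) * Real.exp (-t j S) ^ n) with hb
  have hmass : ∑ c : Fin n → BookLetter X M s, ∏ k, bookMass pQ p (c k) = 1 := by
    rw [← Fintype.sum_pow, sum_bookMass, one_pow]
  have hM' : 0 < ∏ i, (M i : ℝ) := Finset.prod_pos fun i _ => by exact_mod_cast hM i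
  have hw : ∀ w : ∀ i, Fin (M i), ∑ c : Fin n → BookLetter X M s, ∑ y : Fin n → ∀ i, Y i,
      (if (fun j => (bookCode W p 𝒮 t hM c).dec j (fun k => y k j)) ≠ w
        then trialMass W pQ p w c y else 0) ≤ b := by
    intro w
    refine (Finset.sum_le_sum fun c _ => Finset.sum_le_sum fun y _ =>
      error_indicator_le W p t hM h𝒮 c w y (trialMass_nonneg W pQ p w c y)).trans ?_
    rw [sum_sum_sum_comm]
    refine Finset.sum_le_sum fun j _ => ?_
    rw [sum_sum_sum_comm]
    refine Finset.sum_le_sum fun S _ => ?_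
    simp only [Finset.sum_add_distrib]
    refine add_le_add (sum_trialMass_not_passes_le W pQ p w j S _ (hr j S)) ?_
    rw [sum_sum_sum_comm]
    refine (Finset.sum_le_card_nsmul _ _ _ fun w' hw' =>
      sum_trialMass_passes_le W pQ p j (mem_differOn.1 hw') (t j S)).trans (le_of_eq ?_)
    rw [nsmul_eq_mul, card_differOn, Nat.cast_prod]
    congr 1
    refine Finset.prod_congr rfl fun i _ => ?_
    rw [Nat.cast_sub (hM i), Nat.cast_one]
  have havg : ∑ c : Fin n → BookLetter X M s, (∏ k, bookMass pQ p (c k)) *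
      errorProb W (bookCode W p 𝒮 t hM c) ≤ b := by
    have e : ∑ c : Fin n → BookLetter X M s, (∏ k, bookMass pQ p (c k)) *
        errorProb W (bookCode W p 𝒮 t hM c) =
        (∑ w : ∀ i, Fin (M i), ∑ c : Fin n → BookLetter X M s, ∑ y : Fin n → ∀ i, Y i,
          (if (fun j => (bookCode W p 𝒮 t hM c).dec j (fun k => y k j)) ≠ w
            then trialMass W pQ p w c y else 0)) / ∏ i, (M i : ℝ) := by
      rw [Finset.sum_comm, Finset.sum_div]
      refine Finset.sum_congr rfl fun c _ => ?_
      rw [errorProb, mul_div_assoc', Finset.mul_sum]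
      congr 1
      refine Finset.sum_congr rfl fun w _ => ?_
      rw [Finset.mul_sum]
      refine Finset.sum_congr rfl fun y _ => ?_
      split_ifs
      · exact Finset.prod_mul_distrib.symm
      · rw [mul_zero]
    rw [e, div_le_iff₀ hM']
    refine (Finset.sum_le_card_nsmul _ _ _ fun w _ => hw w).trans (le_of_eq ?_)
    rw [nsmul_eq_mul, Finset.card_univ, Fintype.card_pi, mul_comm, Nat.cast_prod]
    simp
  -- If every code exceeded `b`, so would the average; strictness needs a codebook of positive mass.
  by_contra! hcon
  have hne : ∃ c : Fin n → BookLetter X M s, ∏ k, bookMass pQ p (c k) ≠ 0 := by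
    by_contra! h0
    simp [h0] at hmass
  obtain ⟨c₀, hc₀⟩ := hne
  have h0 : ∀ c : Fin n → BookLetter X M s, 0 ≤ ∏ k, bookMass pQ p (c k) := fun c =>
    Finset.prod_nonneg fun k _ => bookMass_nonneg pQ p _
  have : ∑ c : Fin n → BookLetter X M s, (∏ k, bookMass pQ p (c k)) * b <
      ∑ c : Fin n → BookLetter X M s, (∏ k, bookMass pQ p (c k)) *
        errorProb W (bookCode W p 𝒮 t hM c) :=
    Finset.sum_lt_sum (fun c _ => mul_le_mul_of_nonneg_left (hcon _).le (h0 c))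
      ⟨c₀, Finset.mem_univ _, mul_lt_mul_of_pos_left (hcon _)
        (lt_of_le_of_ne (h0 c₀) hc₀.symm)⟩
  rw [← Finset.sum_mul, hmass, one_mul] at this
  linarith

lemma errorProb_nonneg (W : Channel K X Y) (c : Code X Y M n) : 0 ≤ errorProb W c := by
  classical
  refine div_nonneg (Finset.sum_nonneg fun w _ => Finset.sum_nonneg fun y _ => ?_)
    (Finset.prod_nonneg fun i _ => Nat.cast_nonneg _)
  split_ifs
  · exact blockLaw_nonneg W c w y
  · exact le_rfl

/-- Rates at which every receiver can decode all the messages are achievable. -/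
lemma achievable_of_lt_tsInfo {W : Channel K X Y} {R : Fin K → ℝ} (hR : ∀ i, 0 ≤ R i)
    (pQ : stdSimplex ℝ (Fin s)) (p : ∀ i, Fin s → stdSimplex ℝ (X i))
    (h : ∀ j, ∀ S : Finset (Fin K), S.Nonempty → (∀ i ∈ S, 0 < R i) →
      (∑ i ∈ S, R i) * Real.log 2 < tsInfo W pQ p j S) : Achievable W R := by
  classical
  -- A user of rate zero has exactly one message and can never be decoded wrongly, so sets
  -- containing such a user need no test and no strict inequality.
  set 𝒮 : Finset (Finset (Fin K)) :=
    Finset.univ.filter fun S => S.Nonempty ∧ ∀ i ∈ S, 0 < R i with h𝒮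
  have hchoice : ∀ j S, ∃ t r : ℝ, 0 < r ∧ (S ∈ 𝒮 → (∑ i ∈ S, R i) * Real.log 2 < t ∧
      missFactor W pQ p j S t r < 1) := by
    intro j S
    by_cases hS : S ∈ 𝒮
    · have hS' := (Finset.mem_filter.1 hS).2
      obtain ⟨t, ht1, ht2⟩ := exists_between (h j S hS'.1 hS'.2)
      obtain ⟨r, hr, hr1⟩ := exists_missFactor_lt_one W pQ p j S ht2
      exact ⟨t, r, hr, fun _ => ⟨ht1, hr1⟩⟩
    · exact ⟨0, 1, one_pos, fun h => absurd h hS⟩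
  choose t r hr htr using hchoice
  have hcode : ∀ n : ℕ, ∃ c : Code X Y (fun i => ⌈(2 : ℝ) ^ ((n : ℝ) * R i)⌉₊) n,
      errorProb W c ≤ ∑ j, ∑ S ∈ 𝒮, (missFactor W pQ p j S (t j S) (r j S) ^ n +
        Real.exp ((∑ i ∈ S, R i) * Real.log 2 - t j S) ^ n) := by
    intro n
    obtain ⟨c, hc⟩ := exists_code_errorProb_le (M := fun i => ⌈(2 : ℝ) ^ ((n : ℝ) * R i)⌉₊)
      (n := n) W pQ p (𝒮 := 𝒮) t r hr (fun i => by positivity) (by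
        intro S hS hS1
        refine Finset.mem_filter.2 ⟨Finset.mem_univ _, hS, fun i hi => ?_⟩
        refine lt_of_le_of_ne (hR i) fun h0 => ?_
        have := hS1 i hi
        simp [← h0] at this)
    refine ⟨c, hc.trans (Finset.sum_le_sum fun j _ => Finset.sum_le_sum fun S _ =>
      add_le_add_right ?_ _)⟩
    rw [Real.exp_sub, div_eq_mul_inv, ← Real.exp_neg, mul_pow]
    refine mul_le_mul_of_nonneg_right ?_ (by positivity)
    -- Counting only the wrong messages offsets the rounding up, so no constant is lost.
    calc ∏ i ∈ S, ((⌈(2 : ℝ) ^ ((n : ℝ) * R i)⌉₊ : ℝ) - 1)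
        ≤ ∏ i ∈ S, (2 : ℝ) ^ ((n : ℝ) * R i) := by
          refine Finset.prod_le_prod (fun i _ => ?_) fun i _ => ?_
          · have : 0 < ⌈(2 : ℝ) ^ ((n : ℝ) * R i)⌉₊ := by positivity
            have : (1 : ℝ) ≤ ⌈(2 : ℝ) ^ ((n : ℝ) * R i)⌉₊ := by exact_mod_cast this
            linarith
          · have := Nat.ceil_lt_add_one (a := (2 : ℝ) ^ ((n : ℝ) * R i)) (by positivity)
            linarith
      _ = Real.exp ((∑ i ∈ S, R i) * Real.log 2) ^ n := by
          simp only [Real.rpow_def_of_pos (two_pos : (0 : ℝ) < 2)]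
          rw [← Real.exp_sum, ← Real.exp_nat_mul, Finset.sum_mul, Finset.mul_sum]
          congr 1
          refine Finset.sum_congr rfl fun i _ => ?_
          ring
  choose c hc using hcode
  refine ⟨hR, c, squeeze_zero (fun n => errorProb_nonneg W _) hc ?_⟩
  rw [show (0 : ℝ) = ∑ _j : Fin K, ∑ _S ∈ 𝒮, ((0 : ℝ) + 0) by simp]
  refine tendsto_finsetSum _ fun j _ => tendsto_finsetSum _ fun S hS => ?_
  obtain ⟨h1, h2⟩ := htr j S hS
  refine (tendsto_pow_atTop_nhds_zero_of_lt_one (missFactor_nonneg W pQ p j S _ _) h2).add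
    (tendsto_pow_atTop_nhds_zero_of_lt_one (Real.exp_pos _).le ?_)
  rw [Real.exp_lt_one_iff]
  linarith

/-- Under the interference conditions, the bounds of the rate region imply that each receiver can
decode all the messages. -/
lemma sum_rate_le_tsInfo {W : Channel K X Y} {l : Fin K → Fin K}
    (hstrong : ∀ j, IsStrong W (l j) j)
    (hverystrong : ∀ j m, m ≠ j → m ≠ l j → IsVeryStrong W m j) {R : Fin K → ℝ}
    (pQ : stdSimplex ℝ (Fin s)) (p : ∀ i, Fin s → stdSimplex ℝ (X i))
    (h1 : ∀ i, R i * Real.log 2 ≤ tsInfo W pQ p i {i})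
    (h2 : ∀ j, (R j + R (l j)) * Real.log 2 ≤ tsInfo W pQ p j {j, l j})
    (hl : ∀ j, l j ≠ j) (j : Fin K) (S : Finset (Fin K)) :
    (∑ i ∈ S, R i) * Real.log 2 ≤ tsInfo W pQ p j S := by
  have hbase : (∑ i ∈ S ∩ {j, l j}, R i) * Real.log 2 ≤ tsInfo W pQ p j (S ∩ {j, l j}) := by
    have hlj : R (l j) * Real.log 2 ≤ tsInfo W pQ p j {l j} :=
      (h1 (l j)).trans (Finset.sum_le_sum fun q _ =>
        mul_le_mul_of_nonneg_left ((hstrong j).rcvInfo_le _) (pQ.2.1 q))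
    by_cases hj : j ∈ S <;> by_cases hlS : l j ∈ S
    · rw [Finset.inter_eq_right.2 (by simp [Finset.insert_subset_iff, hj, hlS]),
        Finset.sum_pair (hl j).symm]
      exact h2 j
    · have : S ∩ {j, l j} = {j} := by
        ext i; simp only [Finset.mem_inter, Finset.mem_insert, Finset.mem_singleton]
        constructor
        · rintro ⟨hi, rfl | rfl⟩
          · rfl
          · exact absurd hi hlS
        · rintro rfl; exact ⟨hj, Or.inl rfl⟩
      rw [this, Finset.sum_singleton]
      exact h1 j
    · have : S ∩ {j, l j} = {l j} := by
        ext i; simp only [Finset.mem_inter, Finset.mem_insert, Finset.mem_singleton]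
        constructor
        · rintro ⟨hi, rfl | rfl⟩
          · exact absurd hi hj
          · rfl
        · rintro rfl; exact ⟨hlS, Or.inr rfl⟩
      rw [this, Finset.sum_singleton]
      exact hlj
    · have : S ∩ {j, l j} = ∅ := by
        ext i; simp only [Finset.mem_inter, Finset.mem_insert, Finset.mem_singleton,
          Finset.notMem_empty, iff_false]
        rintro ⟨hi, rfl | rfl⟩
        · exact hj hi
        · exact hlS hi
      rw [this]
      simp [tsInfo, rcvInfo]
  -- Very strong interferers are added one by one; each increases the right side by at least the
  -- bound on its own rate.
  have hstep : ∀ D : Finset (Fin K), (∀ m ∈ D, m ≠ j ∧ m ≠ l j) → ∀ S₀ : Finset (Fin K),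
      Disjoint D S₀ → (∑ i ∈ S₀, R i) * Real.log 2 ≤ tsInfo W pQ p j S₀ →
      (∑ i ∈ D ∪ S₀, R i) * Real.log 2 ≤ tsInfo W pQ p j (D ∪ S₀) := by
    intro D
    induction D using Finset.induction_on with
    | empty => intro _ S₀ _ h; simpa using h
    | insert m D hm ih =>
      intro hD S₀ hdisj h
      rw [Finset.disjoint_insert_left] at hdisj
      have hI := ih (fun m' hm' => hD m' (Finset.mem_insert_of_mem hm')) S₀ hdisj.2 h
      have hmn : m ∉ D ∪ S₀ := by simp [hm, hdisj.1]
      have hm1 := hD m (Finset.mem_insert_self m D)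
      have hvs : tsInfo W pQ p m {m} ≤
          tsInfo W pQ p j (insert m (D ∪ S₀)) - tsInfo W pQ p j (D ∪ S₀) := by
        unfold tsInfo
        rw [← Finset.sum_sub_distrib]
        refine Finset.sum_le_sum fun q _ => ?_
        rw [← mul_sub]
        exact mul_le_mul_of_nonneg_left
          ((hverystrong j m hm1.1 hm1.2).rcvInfo_le _ hmn) (pQ.2.1 q)
      rw [Finset.insert_union, Finset.sum_insert hmn, add_mul]
      linarith [h1 m]
  have := hstep (S \ {j, l j}) (fun m hm => by simpa using (Finset.mem_sdiff.1 hm).2)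
    (S ∩ {j, l j}) (Finset.disjoint_sdiff_inter S _) hbase
  rwa [Finset.sdiff_union_inter] at this

/-- Achievability: the rate region is contained in the capacity region. -/
lemma mem_capacityRegion_of_mem_rateRegion {W : Channel K X Y} {l : Fin K → Fin K}
    (hl : ∀ j, l j ≠ j) (hstrong : ∀ j, IsStrong W (l j) j)
    (hverystrong : ∀ j m, m ≠ j → m ≠ l j → IsVeryStrong W m j) {N : ℕ} {R : Fin K → ℝ}
    (h : R ∈ rateRegion W l N) : R ∈ capacityRegion W := by
  obtain ⟨hR, s, -, pQ, p, h1, h2⟩ := (mem_rateRegion_iff W l N R).1 h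
  have hsum := sum_rate_le_tsInfo hstrong hverystrong pQ p h1 h2 hl
  -- Scaling down makes the bounds strict for nonempty sets of users with positive rate, the only
  -- sets for which strictness is required.
  have hlim : Tendsto (fun n : ℕ => (1 - 1 / ((n : ℝ) + 1)) • R) atTop (𝓝 R) := by
    have h1 : Tendsto (fun n : ℕ => (1 : ℝ) - 1 / ((n : ℝ) + 1)) atTop (𝓝 (1 - 0)) :=
      tendsto_const_nhds.sub tendsto_one_div_add_atTop_nhds_zero_nat
    simpa using h1.smul_const R
  refine mem_closure_of_tendsto hlim (Eventually.of_forall fun n => ?_)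
  have hn : 0 < 1 / ((n : ℝ) + 1) := Nat.one_div_pos_of_nat
  have hn1 : 1 / ((n : ℝ) + 1) ≤ 1 := by
    rw [div_le_one (by positivity)]
    linarith [Nat.cast_nonneg (α := ℝ) n]
  have hc : 0 ≤ 1 - 1 / ((n : ℝ) + 1) := by linarith
  refine achievable_of_lt_tsInfo (fun i => mul_nonneg hc (hR i)) pQ p fun j S hS hpos => ?_
  refine lt_of_lt_of_le ?_ (hsum j S)
  simp only [Pi.smul_apply, smul_eq_mul, ← Finset.mul_sum] at hpos ⊢
  refine mul_lt_mul_of_pos_right ?_ log_two_pos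
  have : 0 < ∑ i ∈ S, R i := Finset.sum_pos (fun i hi => pos_of_mul_pos_right (hpos i hi) hc) hS
  nlinarith

end DMIC

theorem theorem3 {K : ℕ} (hK : 3 ≤ K) {X Y : Fin K → Type*}
    [∀ i, Fintype (X i)] [∀ i, Fintype (Y i)] (W : DMIC.Channel K X Y)
    (l : Fin K → Fin K) (hl : ∀ j, l j ≠ j)
    (hstrong : ∀ j, DMIC.IsStrong W (l j) j)
    (hverystrong : ∀ j m, m ≠ j → m ≠ l j → DMIC.IsVeryStrong W m j) :
    DMIC.capacityRegion W = DMIC.rateRegion W l (2 * K + 1) := by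
  refine Set.Subset.antisymm ?_ fun R hR =>
    DMIC.mem_capacityRegion_of_mem_rateRegion hl hstrong hverystrong hR
  exact closure_minimal (fun R hR => hR.mem_rateRegion hl hstrong)
    (DMIC.isClosed_rateRegion W l _)
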